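/- **Ordered rooted trees.** An ordered rooted tree is identified with its bitstring: walk around the tree from the root, visiting children from left to right, and write 1 for each step to a child and 0 for each step back to the parent. Write $\circ$ for concatenation. For a tree $T=(1)\circ T_\ell\circ(0)\circ T_r$ with at least one edge ($T_\ell,T_r$ ordered rooted trees) let $\mathrm{rot}(T)=T_\ell\circ(1)\circ T_r\circ(0)$, i.e. the root is shifted to its leftmost child. The trees obtained from $T$ by repeated rotation are its rotated versions. A leaf is a vertex of degree 1 (the root counts if it has degree 1); it is thin if its neighbour has degree exactly 2 and thick if its neighbour has degree at least 3. A leaf $w$ is the clockwise-next leaf from a leaf $v$ if all edges not on the path from $v$ to $w$ lie to the right of this path (root drawn on top, children in left-to-right order). Trees are compared lexicographically through their bitstrings. **Transformations.** $\mathcal T_{n,1}^*$ is the set of ordered rooted trees with $n\ge 3$ edges of the form $T=(1,1,0,0)\circ R$, and $\tau_1(T)=(1,0,1,0)\circ R$. $\mathcal T_{n,2}^*$ is the set of ordered rooted trees with $n$ edges in which the rightmost child $u$ of the leftmost child $u'$ of the root is a thick leaf and the clockwise-next leaf $v$ from $u$ is thin; $\tau_2(T)$ is obtained by replacing the edge $(u,u')$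 by $(u,v)$. In bitstrings, $$T=(1)\circ T_1\circ(1)\circ T_2\circ(1)\circ\cdots\circ T_{k+1}\circ(1,1,0,0)\circ(0)^k\circ(1,0)\circ(0)\circ T_0,$$ $$\tau_2(T)=(1)\circ T_1\circ(1)\circ T_2\circ(1)\circ\cdots\circ T_{k+1}\circ(1,1,1,0,0,0)\circ(0)^k\circ(0)\circ T_0,$$ with $k\ge 0$ and ordered rooted trees $T_0,\dots,T_{k+1}$. **Selection functions.** For $T\in\mathcal T_{n,1}^*$, $\mathrm{IsFlipTree}_1(T)$ is true iff $T$ is lexicographically smallest among its rotated versions that lie in $\mathcal T_{n,1}^*$. For $T\in\mathcal T_{n,2}^*$, $\mathrm{IsFlipTree}_2(T)$ is false if $T=(1)^{n-1}\circ(0)^{n-2}\circ(1,0,0)$ or if $T$ has more than one thin leaf. Otherwise let $v$ be the unique thin leaf of $T$, $v'$ its parent, $v''$ the parent of $v'$, and $w$ the clockwise-next leaf from $v$. Let $T'$ be obtained from $T$ by replacing the edge $(v,v')$ by $(v,v'')$, so that $v$ becomes a child of $v''$ directly to the left of $v'$, and by rotating so that $w$ becomes the root; let $d$ be the distance in $T'$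 between the root and the leftmost leaf. Consider all rotated versions of $T'$ whose root is a leaf and in which the leftmost leaf $x$ has another leaf as its sibling immediately to the right of $x$; for each of them let $d'$ be the distance between the root and the leftmost leaf. Then $\mathrm{IsFlipTree}_2(T)$ is true iff $d'\le d$ for all of them and $T'$ is lexicographically smallest among those with $d'=d$. **Graphs.** $\mathcal G_n$ is the directed multigraph whose nodes are the classes of ordered rooted trees with $n$ edges that differ by rotation (plane trees), and which has, for each $i\in\{1,2\}$ and each $T\in\mathcal T_{n,i}^*$, one edge from the class of $T$ to the class of $\tau_i(T)$. $\mathcal H_n$ has the same nodes and only those edges for which $\mathrm{IsFlipTree}_i(T)$ is true. **Lemma.** For every $n\ge 1$, the graph $\mathcal H_n$ is a spanning tree of $\mathcal G_n$ (ignoring edge directions: $\mathcal H_n$ is connected, contains all nodes, and has no cycles; in particular it has no loops and no multiple edges). -/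

import Mathlib

/-- An ordered rooted tree: either a single vertex, or `graft L R`. In `graft L R` the subtree
hanging from the leftmost child of the root is `L` (rooted at that child), and `R` (with the same
root) is what remains when the leftmost child and all its descendants are removed. -/
inductive OTree : Type
  | vertex : OTree
  | graft : OTree → OTree → OTree

namespace OTree

/-- The number of edges. -/
def edges : OTree → ℕ
  | vertex => 0
  | graft L R => edges L + edges R + 1

/-- `glue S T` is `S ∘ T`: identify the two roots, with the children of the root of `S` to the left
of the children of the root of `T`. -/
def glue : OTree → OTree → OTree
  | vertex, T => T
  | graft L R, T => graft L (glue R T)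

/-- The bitstring of an ordered rooted tree: walk around the tree, writing the bit 1 (`true`) for
every step to a child and the bit 0 (`false`) for every step back to the parent. -/
def bits : OTree → List Bool
  | vertex => []
  | graft L R => true :: (bits L ++ false :: bits R)

/-- Rotation: shift the root to the leftmost child of the root,
`(1) ∘ L ∘ (0) ∘ R ↦ L ∘ (1) ∘ R ∘ (0)`.
Iterating `rot`, the root walks once around the tree in `2 * edges` steps. -/
def rot : OTree → OTree
  | vertex => vertex
  | graft L R => glue L (graft R vertex)

/-- `S` is a rotated version of `T`. -/
def RotEq (T S : OTree) : Prop := ∃ k : ℕ, rot^[k] T = S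

/-- The tree with one edge, bitstring `(1,0)`. -/
def edge : OTree := graft vertex vertex

/-- The tree that is a path with two edges, rooted at an end, bitstring `(1,1,0,0)`. -/
def path2 : OTree := graft edge vertex

/-- The tree that is a path with three edges, rooted at an end, bitstring `(1,1,1,0,0,0)`. -/
def path3 : OTree := graft path2 vertex

/-- `T` lies in the domain of `τ₁`: it has at least three edges, the leftmost child of the root
has exactly one child, and that child is a leaf, so `T = (1,1,0,0) ∘ R`. -/
def Dom1 (T : OTree) : Prop := 3 ≤ T.edges ∧ ∃ R : OTree, T = path2.glue R

/-- `T` lies in the domain of `τ₁` and `T' = τ₁(T)`, that is,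
`T = (1,1,0,0) ∘ R` and `T' = (1,0,1,0) ∘ R`. -/
def Tau1 (T T' : OTree) : Prop :=
  3 ≤ T.edges ∧ ∃ R : OTree, T = path2.glue R ∧ T' = edge.glue (edge.glue R)

/-- `spine T₁ [T₂, …, T_{k+1}] F` is the tree with bitstring
`T₁ ∘ (1) ∘ T₂ ∘ (1) ∘ ⋯ ∘ (1) ∘ T_{k+1} ∘ F ∘ (0)^k`. -/
def spine : OTree → List OTree → OTree → OTree
  | T₁, [], F => T₁.glue F
  | T₁, T₂ :: Ts, F => T₁.glue (graft (spine T₂ Ts F) vertex)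

/-- `T` lies in the domain of `τ₂` and `T' = τ₂(T)`: the rightmost child `u` of the leftmost child
`u'` of the root is a thick leaf, the clockwise-next leaf `v` of `u` is thin, and `T'` is obtained
by replacing the edge `(u,u')` by the edge `(u,v)`. In bitstrings,
`T  = (1) ∘ T₁ ∘ (1) ∘ ⋯ ∘ (1) ∘ T_{k+1} ∘ (1,1,0,0) ∘ (0)^k ∘ (1,0) ∘ (0) ∘ T₀` and
`T' = (1) ∘ T₁ ∘ (1) ∘ ⋯ ∘ (1) ∘ T_{k+1} ∘ (1,1,1,0,0,0) ∘ (0)^k ∘ (0) ∘ T₀` with `k ≥ 0`. -/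
def Tau2 (T T' : OTree) : Prop :=
  ∃ (T₀ T₁ : OTree) (Ts : List OTree),
    T = graft ((spine T₁ Ts path2).glue edge) T₀ ∧ T' = graft (spine T₁ Ts path3) T₀

/-- The root is a leaf, i.e. it has degree one. -/
def RootLeaf (T : OTree) : Prop := ∃ L : OTree, T = graft L vertex

/-- The root is a thin leaf: it has exactly one child, and this child, being the only neighbour of
the root, has degree exactly two, i.e. it has exactly one child. -/
def RootThin (T : OTree) : Prop := ∃ L : OTree, T = graft (graft L vertex) vertex

open Classical in
/-- The number of thin leaves (leaves whose neighbour has degree two; the root counts as a leaf if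
its degree is one). During the `2 * edges` steps of a full rotation every leaf becomes the root
exactly once, and rotating changes neither degrees nor adjacency. -/
noncomputable def thinLeaves (T : OTree) : ℕ :=
  ((Finset.range (2 * T.edges)).filter fun j => RootThin (rot^[j] T)).card

/-- The distance from the root to the leftmost leaf, i.e. to the vertex reached from the root by
always moving on to the leftmost child. -/
def leftDepth : OTree → ℕ
  | vertex => 0
  | graft L _ => leftDepth L + 1

/-- `LiftLeft S S'`: in `S`, the leftmost leaf `v` is the only child of its parent `v'`, and `v'`
is itself a child of a vertex `v''`; and `S'` is obtained by replacing the edge `(v,v')` by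
`(v,v'')`, so that `v` becomes a child of `v''` directly to the left of `v'`. -/
inductive LiftLeft : OTree → OTree → Prop
  | here (R : OTree) : LiftLeft (graft edge R) (graft vertex (graft vertex R))
  | step (L L' R : OTree) : LiftLeft L L' → LiftLeft (graft L R) (graft L' R)

/-- The parent of the leftmost leaf `x` has another leaf as its child directly to the
right of `x` (so the leftmost two leaves below the root have the same parent). -/
inductive LeftCherry : OTree → Prop
  | here (R : OTree) : LeftCherry (graft vertex (graft vertex R))
  | step (L R : OTree) : LeftCherry L → LeftCherry (graft L R)

/-- The boolean function selecting `τ₁`-edges (for `T` in the domain of `τ₁`): `T` is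
lexicographically smallest among its rotated versions in the domain of `τ₁`. -/
def IsFlipTree1 (T : OTree) : Prop :=
  ∀ S : OTree, RotEq T S → Dom1 S → T.bits ≤ S.bits

/-- The boolean function selecting `τ₂`-edges (for `T` in the domain of `τ₂`, so that `T` has at
least one thin leaf). It is false for the tree `(1)^{n-1} ∘ (0)^{n-2} ∘ (1,0,0)` and for trees with
more than one thin leaf. Otherwise let `v` be the unique thin leaf and `w` the clockwise-next leaf
of `v`. The rotated version `S` of `T` with root `w` is the one whose root is a leaf and whose
leftmost leaf is thin: this leftmost leaf is then `v`, and all edges that are not on the path from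
`v` to the root lie to the right of this path. Then `T'` arises from `S` by moving `v` from its
neighbour `v'` to the other neighbour `v''` of `v'` (this move and the choice of the root do not
interfere, so they may be done in either order). Let `d` be the distance in `T'` between the root
and the leftmost leaf. Among the rotated versions `Q` of `T'` whose root is a leaf and in which the
leftmost leaf has another leaf as its sibling directly to the right, this distance is never larger
than `d`, and `T'` is lexicographically smallest among those for which it equals `d`. -/
def IsFlipTree2 (T : OTree) : Prop :=
  T.bits ≠ List.replicate (T.edges - 1) true ++ List.replicate (T.edges - 2) false
      ++ [true, false, false] ∧
  thinLeaves T ≤ 1 ∧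
  ∃ S T' : OTree, RotEq T S ∧ RootLeaf S ∧ LiftLeft S T' ∧
    ∀ Q : OTree, RotEq T' Q → RootLeaf Q → LeftCherry Q →
      Q.leftDepth ≤ T'.leftDepth ∧ (Q.leftDepth = T'.leftDepth → T'.bits ≤ Q.bits)

theorem edges_glue (S T : OTree) : (S.glue T).edges = S.edges + T.edges := by
  induction S with
  | vertex => simp [glue, edges]
  | graft L R _ ih => simp only [glue, edges, ih]; omega

theorem glue_vertex (S : OTree) : S.glue vertex = S := by
  induction S with
  | vertex => rfl
  | graft L R _ ih => simp only [glue, ih]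

theorem glue_assoc (S T U : OTree) : (S.glue T).glue U = S.glue (T.glue U) := by
  induction S with
  | vertex => rfl
  | graft L R _ ih => simp only [glue, ih]

theorem rot_iterate_glue (L R : OTree) : rot^[2 * L.edges] (L.glue R) = R.glue L := by
  induction L generalizing R with
  | vertex => simp [edges, glue, glue_vertex]
  | graft A B ihA ihB =>
    have h : 2 * (graft A B).edges = 2 * B.edges + (1 + (2 * A.edges + 1)) := by
      simp only [edges]; omega
    rw [h, Function.iterate_add_apply, Function.iterate_add_apply, Function.iterate_add_apply]
    simp only [Function.iterate_one, glue, rot, ihA]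
    rw [glue_assoc, ihB, glue_assoc]
    simp only [glue]

theorem rot_iterate_full (T : OTree) : rot^[2 * T.edges] T = T := by
  simpa only [glue_vertex, glue] using rot_iterate_glue T vertex

theorem RotEq.refl (T : OTree) : RotEq T T := ⟨0, rfl⟩

theorem RotEq.trans {T S U : OTree} : RotEq T S → RotEq S U → RotEq T U := by
  rintro ⟨j, rfl⟩ ⟨k, rfl⟩
  exact ⟨k + j, Function.iterate_add_apply _ _ _ _⟩

theorem RotEq.symm {T S : OTree} : RotEq T S → RotEq S T := by
  rintro ⟨k, rfl⟩
  rcases Nat.eq_zero_or_pos (2 * T.edges) with h | h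
  · have hT : T = vertex := by
      cases T with
      | vertex => rfl
      | graft L R => simp only [edges] at h; omega
    subst hT
    exact ⟨0, (Function.iterate_fixed (f := rot) rfl k)⟩
  · refine ⟨2 * T.edges * k - k, ?_⟩
    rw [← Function.iterate_add_apply, Nat.sub_add_cancel (Nat.le_mul_of_pos_left k h),
      Function.iterate_mul]
    exact Function.iterate_fixed (rot_iterate_full T) k

theorem Tau1.edges_eq {T T' : OTree} : Tau1 T T' → T'.edges = T.edges := by
  rintro ⟨_, R, rfl, rfl⟩
  simp only [edges_glue, edges, path2, edge]; omega

theorem edges_spine (T : OTree) (Ts : List OTree) (F F' : OTree) :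
    (spine T Ts F).edges + F'.edges = (spine T Ts F').edges + F.edges := by
  induction Ts generalizing T with
  | nil => simp only [spine, edges_glue]; omega
  | cons S Ss ih =>
    have := ih S
    simp only [spine, edges_glue, edges]; omega

theorem Tau2.edges_eq {T T' : OTree} : Tau2 T T' → T'.edges = T.edges := by
  rintro ⟨T₀, T₁, Ts, rfl, rfl⟩
  have := edges_spine T₁ Ts path2 path3
  simp only [edges_glue, edges, path2, path3, edge] at this ⊢; omega

/-- "Differ by rotation", as an equivalence relation on the ordered rooted trees with `n` edges. -/
def rotSetoid (n : ℕ) : Setoid {T : OTree // T.edges = n} where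
  r T S := RotEq T.1 S.1
  iseqv := ⟨fun T => RotEq.refl T.1, RotEq.symm, RotEq.trans⟩

end OTree

/-- The plane trees with `n` edges: the classes of ordered rooted trees with `n` edges that differ
by rotation. -/
def PlaneTree (n : ℕ) : Type := Quotient (OTree.rotSetoid n)

/-- The plane tree (rotation class) of an ordered rooted tree with `n` edges. -/
def PlaneTree.mk {n : ℕ} (T : OTree) (h : T.edges = n) : PlaneTree n :=
  Quotient.mk (OTree.rotSetoid n) ⟨T, h⟩

/-- A directed multigraph with nodes `V` and edges `E`; loops and multiple edges are allowed. -/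
structure DiMultigraph (V E : Type*) where
  /-- the node at which an edge starts -/
  src : E → V
  /-- the node at which an edge ends -/
  tgt : E → V

namespace DiMultigraph

variable {V E : Type*}

/-- The unordered pair of end nodes of an edge. -/
def ends (G : DiMultigraph V E) (e : E) : Sym2 V := s(G.src e, G.tgt e)

/-- The spanning subgraph that keeps all nodes, but only the edges in `F`. -/
def restrict (G : DiMultigraph V E) (F : Set E) : DiMultigraph V F where
  src e := G.src e
  tgt e := G.tgt e

/-- A directed multigraph is a tree if, ignoring the directions of its edges, it has no loops
(cycles of length 1), no two edges with the same pair of end nodes (cycles of length 2), and the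
resulting simple graph is a tree, i.e. connected and without cycles. -/
def IsTree (G : DiMultigraph V E) : Prop :=
  (∀ e, G.src e ≠ G.tgt e) ∧ Function.Injective G.ends ∧
    (SimpleGraph.fromEdgeSet (Set.range G.ends)).IsTree

/-- The edges in `F`, together with all nodes of `G`, form a spanning tree of `G`. -/
def IsSpanningTree (G : DiMultigraph V E) (F : Set E) : Prop := (G.restrict F).IsTree

end DiMultigraph

/-- The edges of the graph `𝒢ₙ`: one `τ₁`-edge for every pair `(T,T')` with `T' = τ₁(T)` and one
`τ₂`-edge for every pair `(T,T')` with `T' = τ₂(T)`, where `T` has `n` edges and lies in the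
respective domain. -/
def FlipEdge (n : ℕ) : Type :=
  {p : OTree × OTree // p.1.edges = n ∧ OTree.Tau1 p.1 p.2} ⊕
    {p : OTree × OTree // p.1.edges = n ∧ OTree.Tau2 p.1 p.2}

/-- The directed multigraph `𝒢ₙ`: the edge of `(T,T')` goes from the rotation class of `T` to the
rotation class of `T'`. -/
def flipGraph (n : ℕ) : DiMultigraph (PlaneTree n) (FlipEdge n) where
  src
    | Sum.inl p => PlaneTree.mk p.1.1 p.2.1
    | Sum.inr p => PlaneTree.mk p.1.1 p.2.1
  tgt
    | Sum.inl p => PlaneTree.mk p.1.2 (p.2.2.edges_eq.trans p.2.1)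
    | Sum.inr p => PlaneTree.mk p.1.2 (p.2.2.edges_eq.trans p.2.1)

/-- The edges of the subgraph `ℋₙ` of `𝒢ₙ`: the `τᵢ`-edges of those pairs `(T,T')` for which the
`i`-th boolean function returns true on `T`. -/
def selectedEdges (n : ℕ) : Set (FlipEdge n) := fun e =>
  match e with
  | Sum.inl p => OTree.IsFlipTree1 p.1.1
  | Sum.inr p => OTree.IsFlipTree2 p.1.1

namespace OTree

/-! ### Rotation -/

/-! A connected multigraph with fewer edges than nodes is a tree (`isTree_of_injective`). So it
suffices to show that `ℋₙ` is connected and to map its edges injectively to nodes, missing at least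
one node.

Injection (`Anchor.unique`). A selected `τ₁`-edge is matched with the class of its source, which has
a thin leaf; lexicographic minimality leaves only one such edge per class. A selected `τ₂`-edge is
matched with the class obtained by lifting the only thin leaf of its source, which has no thin leaf.
The lifted tree is the canonical one of its class; it determines the tree before lifting, whose
unique thin leaf determines the source of `τ₂`. For `n ≥ 4` the missed class is that of `D`, the
lift of the excluded tree; for `n = 3` it is the star.

Connectedness. `τ₁` lowers the number of thin leaves, so every class is joined to one without thin
leaves (`exists_linked_thinLeaves_eq_zero`). In such a class undo the lift of the canonical tree
`Q`. This gives a tree `S` with a single thin leaf `v`, and the selected `τ₁`-edge at `S` leads to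
`Q`. A `τ₂`-edge from the class of `S` hangs the next leaf onto `v`, and `τ₁`-edges then remove all
thin leaves while the leftmost path keeps its length gain: it ends in a cherry one level deeper than
in `Q` (`exists_linked_deeper`). Depth is bounded by `n`, and the process can only stop at `D`,
where the required `τ₂`-edge is the excluded one. For `n ≤ 2` there is one node and no edge. -/

theorem edges_rot (T : OTree) : (rot T).edges = T.edges := by
  cases T with
  | vertex => rfl
  | graft L R => simp only [rot, edges_glue, edges]; omega

theorem edges_rot_iterate (k : ℕ) (T : OTree) : (rot^[k] T).edges = T.edges := by
  induction k generalizing T with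
  | zero => rfl
  | succ k ih => rw [Function.iterate_succ_apply, ih, edges_rot]

theorem RotEq.edges_eq {T S : OTree} : RotEq T S → S.edges = T.edges := by
  rintro ⟨k, rfl⟩
  exact edges_rot_iterate k T

theorem rotEq_rot (T : OTree) : RotEq T (rot T) := ⟨1, rfl⟩

theorem rotEq_glue_comm (L R : OTree) : RotEq (L.glue R) (R.glue L) :=
  ⟨_, rot_iterate_glue L R⟩

theorem edges_eq_zero {T : OTree} : T.edges = 0 ↔ T = vertex := by
  cases T <;> simp [edges]

theorem edges_pos {T : OTree} : 0 < T.edges ↔ T ≠ vertex := by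
  rw [Nat.pos_iff_ne_zero, Ne, edges_eq_zero]

theorem edges_eq_one {T : OTree} : T.edges = 1 ↔ T = edge := by
  cases T with
  | vertex => simp [edges, edge]
  | graft L R =>
    simp only [edges, edge, graft.injEq, ← edges_eq_zero]
    omega

@[simp] theorem edges_edge : edge.edges = 1 := rfl

theorem ne_of_edges_ne {S T : OTree} (h : S.edges ≠ T.edges) : S ≠ T := fun e => h (e ▸ rfl)

/-- A full turn is the identity, so all its steps but the first undo the first one. -/
theorem rot_injective : Function.Injective rot := by
  intro S T h
  have he : S.edges = T.edges := by rw [← edges_rot S, h, edges_rot]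
  rcases Nat.eq_zero_or_pos S.edges with h0 | h0
  · exact (edges_eq_zero.1 h0).trans (edges_eq_zero.1 (he ▸ h0)).symm
  · have hS := rot_iterate_full S
    have hT := rot_iterate_full T
    rw [show 2 * S.edges = (2 * S.edges - 1) + 1 by omega, Function.iterate_add_apply] at hS
    rw [← he, show 2 * S.edges = (2 * S.edges - 1) + 1 by omega, Function.iterate_add_apply] at hT
    rw [← hS, ← hT, Function.iterate_one, h]

theorem rot_iterate_mod (T : OTree) (k : ℕ) : rot^[k % (2 * T.edges)] T = rot^[k] T := by
  conv_rhs => rw [← Nat.mod_add_div k (2 * T.edges), Function.iterate_add_apply,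
    Function.iterate_mul, Function.iterate_fixed (rot_iterate_full T)]

theorem RotEq.exists_lt {T S : OTree} (h : RotEq T S) (hT : T ≠ vertex) :
    ∃ k < 2 * T.edges, rot^[k] T = S := by
  obtain ⟨k, rfl⟩ := h
  have := edges_pos.2 hT
  exact ⟨_, Nat.mod_lt k (by omega), rot_iterate_mod T k⟩

theorem finite_rotEq (T : OTree) : {S | RotEq T S}.Finite := by
  by_cases hT : T = vertex
  · subst hT
    refine (Set.finite_singleton vertex).subset ?_
    rintro S ⟨k, rfl⟩
    exact Function.iterate_fixed (f := rot) rfl k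
  · refine ((Set.finite_lt_nat (2 * T.edges)).image fun k => rot^[k] T).subset ?_
    intro S hS
    exact RotEq.exists_lt hS hT

theorem glue_left_injective (X : OTree) : Function.Injective fun S : OTree => S.glue X := by
  intro S T h
  induction S generalizing T with
  | vertex =>
    cases T with
    | vertex => rfl
    | graft L R =>
      have := congrArg edges h
      simp only [edges_glue, edges] at this
      omega
  | graft L R _ ih =>
    cases T with
    | vertex =>
      have := congrArg edges h
      simp only [edges_glue, edges] at this
      omega
    | graft L' R' =>
      simp only [glue, graft.injEq] at h
      rw [h.1, ih h.2]

/-- The code of a subtree ends at the first unmatched `false`. Allowing arbitrary tails behind that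
bit lets the induction split off `L` and then `R`. -/
theorem bits_append_injective {S T : OTree} {u v : List Bool}
    (h : S.bits ++ false :: u = T.bits ++ false :: v) : S = T ∧ u = v := by
  induction S generalizing T u v with
  | vertex =>
    cases T with
    | vertex => simpa [bits] using h
    | graft L R => simp [bits] at h
  | graft L R ihL ihR =>
    cases T with
    | vertex => simp [bits] at h
    | graft L' R' =>
      simp only [bits, List.cons_append, List.append_assoc, List.cons.injEq, true_and] at h
      obtain ⟨h1, h⟩ := ihL h
      obtain ⟨h2, h3⟩ := ihR h
      exact ⟨by rw [h1, h2], h3⟩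

theorem bits_injective : Function.Injective bits := fun S T h =>
  (bits_append_injective (u := []) (v := []) (by rw [h])).1

/-! ### Thin leaves -/

/-- `T` has the form `(1,1,0,0) ∘ R`: the second vertex on the leftmost path is a thin leaf. -/
def ThinDart (T : OTree) : Prop := ∃ R : OTree, T = graft edge R

theorem thinDart_graft {L R : OTree} : ThinDart (graft L R) ↔ L = edge := by
  simp [ThinDart]

theorem rot_rot_graft_edge (R : OTree) : rot (rot (graft edge R)) = graft (graft R vertex) vertex :=
  rfl

/-- Two rotations bring the thin leaf to the root. Thin leaves can therefore be counted through
`ThinDart`, which is visible directly in a `graft`. -/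
theorem rootThin_rot_rot {T : OTree} : RootThin (rot (rot T)) ↔ ThinDart T := by
  constructor
  · rintro ⟨L, h⟩
    exact ⟨L, rot_injective (rot_injective (h.trans (rot_rot_graft_edge L).symm))⟩
  · rintro ⟨L, rfl⟩
    exact ⟨L, rfl⟩

open Classical in
theorem thinLeaves_rot_iterate (T : OTree) (k : ℕ) :
    ((Finset.Ico k (k + 2 * T.edges)).filter fun j => RootThin (rot^[j] T)).card
      = thinLeaves T := by
  have hp : Function.Periodic (fun j => RootThin (rot^[j] T)) (2 * T.edges) := by
    intro j
    dsimp only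
    rw [Function.iterate_add_apply, rot_iterate_full]
  rw [Nat.filter_Ico_card_eq_of_periodic _ _ _ hp, thinLeaves, Nat.count_eq_card_filter_range]

theorem RotEq.thinLeaves_eq {T S : OTree} (h : RotEq T S) : thinLeaves S = thinLeaves T := by
  classical
  have he := h.edges_eq
  obtain ⟨k, rfl⟩ := h
  rw [← thinLeaves_rot_iterate T k, thinLeaves, he]
  refine Finset.card_bij (fun j _ => k + j) ?_ ?_ ?_
  · intro j hj
    simp only [Finset.mem_filter, Finset.mem_range, Finset.mem_Ico] at hj ⊢
    refine ⟨by omega, ?_⟩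
    rw [add_comm, Function.iterate_add_apply]
    exact hj.2
  · intro a _ b _ h
    omega
  · intro j hj
    simp only [Finset.mem_filter, Finset.mem_range, Finset.mem_Ico] at hj ⊢
    refine ⟨j - k, ⟨by omega, ?_⟩, by omega⟩
    rw [← Function.iterate_add_apply, show j - k + k = j by omega]
    exact hj.2

open Classical in
/-- The number of thin leaves that the first `m` rotations of `T` pass. -/
noncomputable def thinCount (T : OTree) (m : ℕ) : ℕ := Nat.count (fun j => ThinDart (rot^[j] T)) m

theorem thinLeaves_eq_thinCount (T : OTree) : thinLeaves T = thinCount T (2 * T.edges) := by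
  classical
  have h : RotEq T (rot^[2] T) := ⟨2, rfl⟩
  rw [← h.thinLeaves_eq, thinLeaves, h.edges_eq, thinCount, Nat.count_eq_card_filter_range]
  congr 1
  refine Finset.filter_congr fun j _ => ?_
  rw [← rootThin_rot_rot, ← Function.iterate_add_apply, add_comm, Function.iterate_add_apply]
  rfl

theorem thinCount_add (T : OTree) (a b : ℕ) :
    thinCount T (a + b) = thinCount T a + thinCount (rot^[a] T) b := by
  classical
  rw [thinCount, Nat.count_add]
  simp only [thinCount, ← Function.iterate_add_apply, add_comm]

open Classical in
theorem thinCount_one (T : OTree) : thinCount T 1 = if ThinDart T then 1 else 0 := by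
  simp only [thinCount, Nat.count_succ, Nat.count_zero, Function.iterate_zero, id, zero_add]
  congr

theorem rot_iterate_graft_glue (A B X : OTree) :
    rot^[2 * A.edges + 1] ((graft A B).glue X) = graft (B.glue X) A := by
  rw [Function.iterate_succ_apply]
  simp only [glue, rot]
  rw [rot_iterate_glue, glue]
  rfl

theorem rot_iterate_graft_glue' (A B X : OTree) :
    rot^[1 + 2 * A.edges + 1] ((graft A B).glue X) = B.glue (X.glue (graft A vertex)) := by
  rw [Function.iterate_succ_apply', add_comm 1, rot_iterate_graft_glue, rot, glue_assoc]

open Classical in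
-- The walk around `graft A B` has four phases: the step down the first edge, the tour of `A`, the
-- step back up (seen from below, the old root carries `B` and `X`), and the tour of `B`.
theorem thinCount_graft_glue (A B X : OTree) :
    thinCount ((graft A B).glue X) (2 * (graft A B).edges) =
      (if A = edge then 1 else 0) + thinCount (A.glue (graft (B.glue X) vertex)) (2 * A.edges)
        + (if B.glue X = edge then 1 else 0)
        + thinCount (B.glue (X.glue (graft A vertex))) (2 * B.edges) := by
  rw [show 2 * (graft A B).edges = 1 + 2 * A.edges + 1 + 2 * B.edges by simp only [edges]; omega,
    thinCount_add, thinCount_add _ _ 1, thinCount_add, thinCount_one, thinCount_one,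
    rot_iterate_graft_glue', add_comm 1 (2 * A.edges), rot_iterate_graft_glue,
    Function.iterate_one]
  simp only [glue, rot, thinDart_graft]

open Classical in
/-- The number of thin leaves of `T` with their neighbour and its parent below the root. -/
noncomputable def innerThin : OTree → ℕ
  | vertex => 0
  | graft L R => (if L = edge then 1 else 0) + innerThin L + innerThin R

theorem thinCount_zero (T : OTree) : thinCount T 0 = 0 := by simp [thinCount]

/-- Seen from below, the part above an edge contains `X`, hence at least two edges. Steps back up
therefore never point at a thin leaf, and only the steps down count. -/
theorem thinCount_glue (L X : OTree) (hX : 2 ≤ X.edges) :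
    thinCount (L.glue X) (2 * L.edges) = innerThin L := by
  induction L generalizing X with
  | vertex => exact thinCount_zero _
  | graft A B ihA ihB =>
    rw [thinCount_graft_glue, ihA, ihB, if_neg (c := B.glue X = edge), innerThin, add_zero]
    · exact ne_of_edges_ne (by rw [edges_glue]; simp; omega)
    · rw [edges_glue]; omega
    · simp only [edges, edges_glue]; omega

open Classical in
theorem thinLeaves_graft (A B : OTree) :
    thinLeaves (graft A B) =
      (if A = edge then 1 else 0) + thinCount (A.glue (graft B vertex)) (2 * A.edges)
        + (if B = edge then 1 else 0) + thinCount (B.glue (graft A vertex)) (2 * B.edges) := by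
  have := thinCount_graft_glue A B vertex
  rwa [glue_vertex, glue_vertex, ← thinLeaves_eq_thinCount] at this

theorem innerThin_edge : innerThin edge = 0 := by
  simp [edge, innerThin]

theorem thinLeaves_graft_edge {R : OTree} (hR : R ≠ vertex) :
    1 + innerThin R ≤ thinLeaves (graft edge R) := by
  have := edges_pos.2 hR
  rw [thinLeaves_graft, if_pos rfl, thinCount_glue R _ (by simp [edges])]
  omega

theorem thinLeaves_graft_vertex_vertex {R : OTree} (hR : R ≠ vertex) :
    thinLeaves (graft vertex (graft vertex R)) = innerThin R := by
  have := edges_pos.2 hR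
  have h := thinCount_graft_glue vertex R edge
  rw [show (graft vertex R).glue edge = (graft vertex R).glue (graft vertex vertex) from rfl] at h
  rw [thinLeaves_graft, if_neg (by simp [edge]), if_neg (by simpa [edge] using hR), h,
    if_neg (by simp [edge]), if_neg, thinCount_glue R _ (by simp [edges_glue, edges])]
  · simp [edges, thinCount_zero]
  · exact ne_of_edges_ne (by rw [edges_glue]; simp; omega)

/-- After the lift, the former thin leaf and its neighbour are leaves at a common vertex, which has
degree at least three since `R` is nonempty; so neither is thin and no new thin leaf arises. -/
theorem thinLeaves_contract_lt {R : OTree} (hR : R ≠ vertex) :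
    thinLeaves (graft vertex (graft vertex R)) < thinLeaves (graft edge R) := by
  have := thinLeaves_graft_edge hR
  rw [thinLeaves_graft_vertex_vertex hR]
  omega

open Classical in
theorem thinLeaves_rootLeaf (A B : OTree) :
    thinLeaves (graft (graft A B) vertex) =
      (if graft A B = edge then 1 else 0) + (if B = vertex then 1 else 0)
        + innerThin (graft A B) := by
  have h := thinCount_graft_glue A B edge
  rw [show (graft A B).glue edge = (graft A B).glue (graft vertex vertex) from rfl] at h
  have hB : B.glue edge = edge ↔ B = vertex := by
    rw [← edges_eq_one, edges_glue, edges_edge, ← edges_eq_zero]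
    omega
  rw [thinLeaves_graft, h, if_neg (show vertex ≠ edge by simp [edge]),
    thinCount_glue A _ (by simp [edges_glue, edges]),
    thinCount_glue B _ (by simp [edges_glue, edges]; omega), innerThin]
  simp only [hB, glue, edges, mul_zero, thinCount_zero]
  omega

theorem thinLeaves_eq_zero_rootLeaf {A B : OTree} (h : thinLeaves (graft (graft A B) vertex) = 0) :
    B ≠ vertex ∧ innerThin (graft A B) = 0 := by
  classical
  rw [thinLeaves_rootLeaf] at h
  refine ⟨?_, by omega⟩
  rintro rfl
  simp at h

open Classical in
theorem thinLeaves_graft_vertex_graft (Z : OTree) :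
    1 + (if Z = edge then 1 else 0) + innerThin Z ≤ thinLeaves (graft vertex (graft Z vertex)) := by
  have h := thinCount_graft_glue Z vertex edge
  rw [show (graft Z vertex).glue edge = (graft Z vertex).glue (graft vertex vertex) from rfl] at h
  rw [thinLeaves_graft, h, if_pos (c := vertex.glue edge = edge) rfl, thinCount_glue Z _ (by simp [edges_glue, edges])]
  omega

theorem RotEq.ne_vertex {T S : OTree} (h : RotEq T S) (hT : T ≠ vertex) : S ≠ vertex := by
  rw [← edges_pos] at *
  rwa [h.edges_eq]

/-- Each thin leaf is the root at exactly one position of a full turn, so a single thin leaf fixes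
the position. -/
theorem rootThin_unique {T V W : OTree} (hT : thinLeaves T ≤ 1) (hV : RotEq T V) (hW : RotEq T W)
    (tV : RootThin V) (tW : RootThin W) : V = W := by
  classical
  by_cases h0 : T = vertex
  · obtain ⟨k, rfl⟩ := hV
    obtain ⟨l, rfl⟩ := hW
    rw [h0, Function.iterate_fixed (f := rot) rfl k, Function.iterate_fixed (f := rot) rfl l]
  · obtain ⟨k, hk, rfl⟩ := hV.exists_lt h0
    obtain ⟨l, hl, rfl⟩ := hW.exists_lt h0
    rw [Finset.card_le_one.1 hT k (by simp [hk, tV]) l (by simp [hl, tW])]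

theorem graft_edge_unique {T R R' : OTree} (hT : thinLeaves T ≤ 1) (h : RotEq T (graft edge R))
    (h' : RotEq T (graft edge R')) : R = R' := by
  have := rootThin_unique hT (h.trans ⟨2, rot_rot_graft_edge R⟩)
    (h'.trans ⟨2, rot_rot_graft_edge R'⟩) ⟨R, rfl⟩ ⟨R', rfl⟩
  simpa using this

theorem thinLeaves_pos {T : OTree} (h : 0 < thinLeaves T) : ∃ R, RotEq T (graft edge R) := by
  classical
  obtain ⟨j, hj⟩ := Finset.card_pos.1 h
  obtain ⟨L, hL⟩ := (Finset.mem_filter.1 hj).2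
  have h1 : RotEq (graft edge L) (rot^[j] T) := ⟨2, (rot_rot_graft_edge L).trans hL.symm⟩
  exact ⟨L, RotEq.trans ⟨j, rfl⟩ h1.symm⟩


/-! ### Lifting the leftmost leaf -/

theorem LiftLeft.glue {S T : OTree} (h : LiftLeft S T) (X : OTree) :
    LiftLeft (S.glue X) (T.glue X) := by
  cases h with
  | here R => exact .here _
  | step L L' R h => exact .step _ _ _ h

theorem LiftLeft.edges_eq {S T : OTree} (h : LiftLeft S T) : T.edges = S.edges := by
  induction h with
  | here R => simp [edges, edge]; omega
  | step L L' R _ ih => simp [edges, ih]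

theorem LiftLeft.leftDepth_eq {S T : OTree} (h : LiftLeft S T) :
    S.leftDepth = T.leftDepth + 1 := by
  induction h with
  | here R => rfl
  | step L L' R _ ih => simp [leftDepth, ih]

theorem LiftLeft.left_unique {S S' T : OTree} (h : LiftLeft S T) (h' : LiftLeft S' T) :
    S = S' := by
  induction h generalizing S' with
  | here R =>
    cases h' with
    | here => rfl
    | step L L' R h => cases h
  | step L L' R h ih =>
    cases h' with
    | here => cases h
    | step L₂ _ _ h' => rw [ih h']

theorem LiftLeft.leftCherry {S T : OTree} (h : LiftLeft S T) : LeftCherry T := by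
  induction h with
  | here R => exact .here R
  | step L L' R _ ih => exact .step _ _ ih

theorem LeftCherry.exists_liftLeft {T : OTree} (h : LeftCherry T) : ∃ S, LiftLeft S T := by
  induction h with
  | here R => exact ⟨_, .here R⟩
  | step L R _ ih =>
    obtain ⟨S, hS⟩ := ih
    exact ⟨_, .step _ _ R hS⟩

theorem leftDepth_glue {S : OTree} (hS : S ≠ vertex) (X : OTree) :
    (S.glue X).leftDepth = S.leftDepth := by
  cases S with
  | vertex => exact absurd rfl hS
  | graft L R => rfl

/-- Walk down the leftmost path until `v''` is the root. The same rotations apply to both trees,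
since the lift happens below them. -/
theorem LiftLeft.exists_rotEq {S T : OTree} (h : LiftLeft S T) :
    ∃ R, RotEq S (graft edge R) ∧ RotEq T (graft vertex (graft vertex R)) := by
  induction hd : S.leftDepth generalizing S T with
  | zero => cases h <;> simp [leftDepth] at hd
  | succ d ih =>
    cases h with
    | here R => exact ⟨R, .refl _, .refl _⟩
    | step L L' R h =>
      have hL : L ≠ vertex := by rintro rfl; cases h
      obtain ⟨X, h1, h2⟩ := ih (h.glue (graft R vertex))
        (by rw [leftDepth_glue hL]; simpa [leftDepth] using hd)
      exact ⟨X, (rotEq_rot _).trans h1, (rotEq_rot _).trans h2⟩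

/-! ### Leftmost and rightmost paths -/

/-- The tree whose leftmost path has the trees `R₁, …, R_d` to its right. -/
def leftSpine : List OTree → OTree
  | [] => vertex
  | R :: Rs => graft (leftSpine Rs) R

/-- The tree whose rightmost path has the trees `R₁, …, R_d` to its left, where `Rᵢ` is attached to
the `i`-th vertex below the root. -/
def rightSpine : List OTree → OTree
  | [] => vertex
  | R :: Rs => graft (R.glue (rightSpine Rs)) vertex

theorem leftDepth_leftSpine (Rs : List OTree) : (leftSpine Rs).leftDepth = Rs.length := by
  induction Rs with
  | nil => rfl
  | cons R Rs ih => simp [leftSpine, leftDepth, ih]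

/-- Walking down the leftmost path turns it over: it becomes the rightmost path, and the trees to
its right end up to its left. This connects a leaf with its clockwise-next leaf. -/
theorem rot_iterate_leftSpine_glue (Rs Ss : List OTree) :
    rot^[Rs.length] ((leftSpine Rs).glue (rightSpine Ss)) = rightSpine (Rs.reverse ++ Ss) := by
  induction Rs generalizing Ss with
  | nil => rfl
  | cons R Rs ih =>
    rw [List.length_cons, Function.iterate_succ_apply]
    simp only [leftSpine, glue, rot, List.reverse_cons, List.append_assoc, List.singleton_append]
    exact ih (R :: Ss)

theorem rot_iterate_leftSpine (Rs : List OTree) :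
    rot^[Rs.length] (leftSpine Rs) = rightSpine Rs.reverse := by
  simpa [rightSpine, glue_vertex] using rot_iterate_leftSpine_glue Rs []

theorem exists_glue_last {L : OTree} (hL : L ≠ vertex) :
    ∃ A B : OTree, L = A.glue (graft B vertex) := by
  induction L with
  | vertex => exact absurd rfl hL
  | graft L R _ ih =>
    by_cases hR : R = vertex
    · exact ⟨vertex, L, by rw [hR]; rfl⟩
    · obtain ⟨A, B, rfl⟩ := ih hR
      exact ⟨graft L A, B, rfl⟩

theorem exists_rightSpine (L : OTree) : ∃ Rs, graft L vertex = rightSpine (Rs ++ [vertex]) := by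
  induction hn : L.edges using Nat.strong_induction_on generalizing L with
  | _ n ih =>
    by_cases hL : L = vertex
    · exact ⟨[], by rw [hL]; rfl⟩
    · obtain ⟨A, B, rfl⟩ := exists_glue_last hL
      simp only [edges_glue, edges] at hn
      obtain ⟨Rs, hRs⟩ := ih B.edges (by omega) B rfl
      exact ⟨A :: Rs, by rw [hRs]; rfl⟩

/-- Extend the rightmost leaf by one edge. -/
def extendRight : OTree → OTree
  | vertex => edge
  | graft L vertex => graft (extendRight L) vertex
  | graft L (graft A B) => graft L (extendRight (graft A B))

theorem extendRight_glue (S : OTree) {T : OTree} (hT : T ≠ vertex) :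
    extendRight (S.glue T) = S.glue (extendRight T) := by
  induction S with
  | vertex => rfl
  | graft L R _ ih =>
    simp only [glue]
    rw [← ih]
    cases h : R.glue T with
    | vertex =>
      have := congrArg edges h
      have h2 := edges_pos.2 hT
      rw [edges_glue] at this
      simp only [edges] at this
      omega
    | graft A B => rfl

theorem extendRight_spine (T : OTree) (Ts : List OTree) {F : OTree} (hF : F ≠ vertex) :
    extendRight (spine T Ts F) = spine T Ts (extendRight F) := by
  induction Ts generalizing T with
  | nil => exact extendRight_glue T hF
  | cons S Ss ih =>
    rw [spine, extendRight_glue T (by simp), extendRight, ih]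
    rfl

theorem path2_ne_vertex : path2 ≠ vertex := by simp [path2]

/-- Extending the rightmost leaf refers only to the whole spine, so the decomposition into `T₁` and
`Ts` need not be shown unique. -/
theorem tau2_functional {T S S' : OTree} (h : Tau2 T S) (h' : Tau2 T S') : S = S' := by
  obtain ⟨T₀, T₁, Ts, rfl, rfl⟩ := h
  obtain ⟨T₀', T₁', Ts', h, rfl⟩ := h'
  simp only [graft.injEq] at h
  obtain ⟨h, rfl⟩ := h
  have h := glue_left_injective _ h
  have e : path3 = extendRight path2 := rfl
  rw [e, ← extendRight_spine _ _ path2_ne_vertex, h, extendRight_spine _ _ path2_ne_vertex]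

theorem tau1_functional {T S S' : OTree} (h : Tau1 T S) (h' : Tau1 T S') : S = S' := by
  obtain ⟨_, R, rfl, rfl⟩ := h
  obtain ⟨_, R', h, rfl⟩ := h'
  simp only [path2, glue, graft.injEq, true_and] at h
  rw [h]

theorem graft_spine_eq_rightSpine (T : OTree) (Ts : List OTree) :
    graft (spine T Ts path2) vertex = rightSpine (T :: (Ts ++ [vertex, vertex])) := by
  induction Ts generalizing T with
  | nil => rfl
  | cons S Ss ih => rw [spine, ih]; rfl

theorem graft_spine_glue (S T : OTree) (Ts : List OTree) (F : OTree) :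
    S.glue (spine T Ts F) = spine (S.glue T) Ts F := by
  cases Ts <;> simp only [spine, glue_assoc]

theorem exists_rootThin_spine (T : OTree) (Ts : List OTree) :
    ∃ V, RootThin V ∧ rot^[V.leftDepth] V = graft (spine T Ts path2) vertex := by
  refine ⟨leftSpine (T :: (Ts ++ [vertex, vertex])).reverse,
    ⟨leftSpine (T :: Ts).reverse, ?_⟩, ?_⟩
  · simp [leftSpine]
  · rw [leftDepth_leftSpine, rot_iterate_leftSpine, List.reverse_reverse,
      graft_spine_eq_rightSpine]

theorem rotEq_graft_glue_edge (X T₀ : OTree) :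
    RotEq (graft (X.glue edge) T₀) (graft vertex (graft T₀ X)) := by
  refine (rotEq_rot _).trans ?_
  rw [rot, glue_assoc]
  exact rotEq_glue_comm _ _

theorem rotEq_graft_glue_edge_root (X T₀ : OTree) :
    RotEq (graft (X.glue edge) T₀) (graft (graft T₀ X) vertex) :=
  (rotEq_graft_glue_edge X T₀).trans (rotEq_rot _)

/-- Root the class at its only thin leaf `v`. The leftmost path from `v` ends at `u`, and the
version rooted at `u` displays `T₀` and the spine. -/
theorem tau2_source_unique {T T' S S' : OTree} (h : Tau2 T T') (h' : Tau2 S S')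
    (hTS : RotEq T S) (hT : thinLeaves T ≤ 1) : T = S := by
  obtain ⟨T₀, T₁, Ts, rfl, -⟩ := h
  obtain ⟨S₀, S₁, Ss, rfl, -⟩ := h'
  obtain ⟨V, tV, hV⟩ := exists_rootThin_spine (graft T₀ T₁) Ts
  obtain ⟨W, tW, hW⟩ := exists_rootThin_spine (graft S₀ S₁) Ss
  rw [show graft T₀ T₁ = (graft T₀ vertex).glue T₁ from rfl, ← graft_spine_glue] at hV
  rw [show graft S₀ S₁ = (graft S₀ vertex).glue S₁ from rfl, ← graft_spine_glue] at hW
  have rV := (rotEq_graft_glue_edge_root (spine T₁ Ts path2) T₀).trans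
    (RotEq.symm ⟨_, hV⟩)
  have rW := hTS.trans ((rotEq_graft_glue_edge_root (spine S₁ Ss path2) S₀).trans
    (RotEq.symm ⟨_, hW⟩))
  rw [rootThin_unique hT rV rW tV tW, hW] at hV
  simp only [glue, graft.injEq, and_true] at hV
  rw [hV.1, hV.2]

/-! ### Paths -/

/-- The path with `k` edges, rooted at an end. -/
def path : ℕ → OTree
  | 0 => vertex
  | k + 1 => graft (path k) vertex

theorem leftDepth_path (k : ℕ) : (path k).leftDepth = k := by
  induction k with
  | zero => rfl
  | succ k ih => simp [path, leftDepth, ih]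

theorem edges_path (k : ℕ) : (path k).edges = k := by
  induction k with
  | zero => rfl
  | succ k ih => simp [path, edges, ih]

theorem leftDepth_le_edges (T : OTree) : T.leftDepth ≤ T.edges := by
  induction T with
  | vertex => rfl
  | graft L R ih _ => simp only [leftDepth, edges]; omega

theorem eq_path_of_edges_le {T : OTree} (h : T.edges ≤ T.leftDepth) : T = path T.leftDepth := by
  induction T with
  | vertex => rfl
  | graft L R ih _ =>
    simp only [leftDepth, edges] at h ⊢
    have := leftDepth_le_edges L
    rw [edges_eq_zero.1 (show R.edges = 0 by omega), path, ← ih (by omega)]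

theorem path_eq_spine (k : ℕ) : ∃ Ts, path (k + 2) = spine vertex Ts path2 := by
  induction k with
  | zero => exact ⟨[], rfl⟩
  | succ k ih =>
    obtain ⟨Ts, h⟩ := ih
    exact ⟨vertex :: Ts, by rw [path, h]; rfl⟩

theorem extendRight_path (k : ℕ) : extendRight (path k) = path (k + 1) := by
  induction k with
  | zero => rfl
  | succ k ih => rw [path, extendRight, ih]; rfl


/-! ### Moving the leaf after the leftmost leaf -/

/-- `DropLeft T T'`: `T'` arises from `T` by removing the leftmost leaf. -/
inductive DropLeft : OTree → OTree → Prop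
  | here (R : OTree) : DropLeft (graft vertex R) R
  | step (L L' R : OTree) : DropLeft L L' → DropLeft (graft L R) (graft L' R)

theorem DropLeft.exists {T : OTree} (hT : T ≠ vertex) : ∃ T', DropLeft T T' := by
  induction T with
  | vertex => exact absurd rfl hT
  | graft L R ih _ =>
    by_cases hL : L = vertex
    · exact ⟨R, hL ▸ .here R⟩
    · obtain ⟨L', h⟩ := ih hL
      exact ⟨_, .step _ _ R h⟩

theorem DropLeft.edges_eq {T T' : OTree} (h : DropLeft T T') : T.edges = T'.edges + 1 := by
  induction h with
  | here R => simp [edges]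
  | step L L' R _ ih => simp only [edges]; omega

/-- `MoveNext S Q`: the leftmost leaf `v` of `S` is a thin leaf, and `Q` arises from `S` by
removing the next leaf to the right of `v` and attaching it to `v`. -/
inductive MoveNext : OTree → OTree → Prop
  | branch (k : ℕ) (R R' : OTree) : DropLeft R R' →
      MoveNext (graft (path (k + 1)) R) (graft (path (k + 2)) R')
  | step (L L' R : OTree) : MoveNext L L' → MoveNext (graft L R) (graft L' R)

theorem DropLeft.glue {S T : OTree} (h : DropLeft S T) (X : OTree) :
    DropLeft (S.glue X) (T.glue X) := by
  cases h with
  | here R => exact .here _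
  | step L L' R h => exact .step _ _ _ h

theorem MoveNext.glue {S T : OTree} (h : MoveNext S T) (X : OTree) :
    MoveNext (S.glue X) (T.glue X) := by
  cases h with
  | branch k R R' h => exact .branch k _ _ (h.glue X)
  | step L L' R h => exact .step _ _ _ h

/-- Move the root to the parent of the dropped leaf. Every vertex left behind on the way down
becomes one more vertex on the spine leading to `v`. -/
theorem DropLeft.exists_spine {R R' : OTree} (h : DropLeft R R') (T : OTree) (Ts : List OTree) :
    ∃ U Us, RotEq (R.glue (spine T Ts path2)) (graft vertex (spine U Us path2)) ∧
      RotEq (R'.glue (spine T Ts path3)) (spine U Us path3) := by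
  induction h generalizing T Ts with
  | here R =>
    refine ⟨R.glue T, Ts, ?_, ?_⟩ <;> rw [← graft_spine_glue] <;> exact .refl _
  | step L L' R _ ih =>
    obtain ⟨U, Us, h1, h2⟩ := ih vertex (R.glue T :: Ts)
    refine ⟨U, Us, (rotEq_rot _).trans ?_, (rotEq_rot _).trans ?_⟩
    · rwa [spine, ← graft_spine_glue] at h1
    · rwa [spine, ← graft_spine_glue] at h2

theorem MoveNext.exists_spine {S Q : OTree} (h : MoveNext S Q) :
    ∃ U Us, RotEq S (graft vertex (spine U Us path2)) ∧ RotEq Q (spine U Us path3) := by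
  induction hd : S.leftDepth generalizing S Q with
  | zero => cases h <;> simp [leftDepth] at hd
  | succ d ih =>
    cases h with
    | branch k R R' h =>
      obtain ⟨Ts, hTs⟩ := path_eq_spine k
      have hTs' : path (k + 3) = spine vertex Ts path3 := by
        rw [← extendRight_path, hTs, extendRight_spine _ _ path2_ne_vertex]
        rfl
      obtain ⟨U, Us, h1, h2⟩ := h.exists_spine vertex Ts
      rw [← hTs] at h1
      rw [← hTs'] at h2
      exact ⟨U, Us, (rotEq_glue_comm (path (k + 2)) R).trans h1,
        (rotEq_glue_comm (path (k + 3)) R').trans h2⟩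
    | step L L' R h =>
      have hL : L ≠ vertex := by rintro rfl; cases h
      obtain ⟨U, Us, h1, h2⟩ := ih (h.glue (graft R vertex))
        (by rw [leftDepth_glue hL]; simpa [leftDepth] using hd)
      exact ⟨U, Us, (rotEq_rot _).trans h1, (rotEq_rot _).trans h2⟩

theorem innerThin_glue (S T : OTree) : innerThin (S.glue T) = innerThin S + innerThin T := by
  induction S with
  | vertex => simp [glue, innerThin]
  | graft L R _ ih => simp only [glue, innerThin, ih]; omega

theorem one_le_innerThin_spine (T : OTree) (Ts : List OTree) :
    1 ≤ innerThin (spine T Ts path2) := by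
  induction Ts generalizing T with
  | nil =>
    rw [spine, innerThin_glue]
    simp [path2, innerThin]; omega
  | cons S Ss ih =>
    have := ih S
    rw [spine, innerThin_glue]
    simp only [innerThin]; omega

/-- This realises the move as `τ₂`. What has to be supplied is that the moved leaf `u` is thick; the
first branch `A` at its neighbour then serves as the subtree towards the root of the `τ₂`-source. -/
theorem MoveNext.exists_tau2 {S Q : OTree} (h : MoveNext S Q) (hS : thinLeaves S ≤ 1) :
    ∃ T T', Tau2 T T' ∧ RotEq T S ∧ RotEq T' Q := by
  classical
  obtain ⟨U, Us, h1, h2⟩ := h.exists_spine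
  rw [← h1.thinLeaves_eq] at hS
  cases U with
  | vertex =>
    -- Here the neighbour of `u` has degree two, so `u` is a thin leaf besides `v`.
    exfalso
    cases Us with
    | nil =>
      have := thinLeaves_graft_vertex_graft edge
      rw [if_pos rfl] at this
      change thinLeaves (graft vertex (graft edge vertex)) ≤ 1 at hS
      omega
    | cons V Vs =>
      have := thinLeaves_graft_vertex_graft (spine V Vs path2)
      have := one_le_innerThin_spine V Vs
      change thinLeaves (graft vertex (graft (spine V Vs path2) vertex)) ≤ 1 at hS
      omega
  | graft A B =>
    have e : ∀ F, spine (graft A B) Us F = graft A (spine B Us F) := fun F =>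
      (graft_spine_glue (graft A vertex) B Us F).symm
    rw [e] at h1 h2
    refine ⟨_, _, ⟨A, B, Us, rfl, rfl⟩, ?_, ?_⟩
    · exact (rotEq_graft_glue_edge _ _).trans h1.symm
    · exact (rotEq_rot _).trans ((rotEq_glue_comm _ _).trans h2.symm)

/-! ### Contracting thin leaves -/

/-- `LeftEnd k T`: the leftmost leaf of `T` has depth `k` and another leaf as its sibling directly
to the right, or it is a thin leaf of depth `k + 1`. -/
inductive LeftEnd : ℕ → OTree → Prop
  | cherry (R : OTree) : LeftEnd 1 (graft vertex (graft vertex R))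
  | thin (R : OTree) : LeftEnd 1 (graft edge R)
  | step (k : ℕ) (L R : OTree) : LeftEnd k L → LeftEnd (k + 1) (graft L R)

theorem LeftEnd.leftCherry {k : ℕ} {T : OTree} (h : LeftEnd k T) (hT : innerThin T = 0) :
    LeftCherry T ∧ T.leftDepth = k := by
  induction h with
  | cherry R => exact ⟨.here R, rfl⟩
  | thin R => simp [innerThin] at hT
  | step k L R _ ih =>
    simp only [innerThin] at hT
    obtain ⟨h1, h2⟩ := ih (by omega)
    exact ⟨.step _ _ h1, by rw [leftDepth, h2]⟩

theorem leftEnd_path (k : ℕ) : LeftEnd (k + 1) (path (k + 2)) := by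
  induction k with
  | zero => exact .thin vertex
  | succ k ih => exact .step _ _ _ ih

/-- `Contract T T'`: `T'` arises from `T` by lifting a thin leaf `v` with neighbour `v'` to the
parent of `v'`. -/
inductive Contract : OTree → OTree → Prop
  | here (R : OTree) : Contract (graft edge R) (graft vertex (graft vertex R))
  | left (L L' R : OTree) : Contract L L' → Contract (graft L R) (graft L' R)
  | right (L R R' : OTree) : Contract R R' → Contract (graft L R) (graft L R')

theorem not_contract_edge {T : OTree} : ¬ Contract edge T := by
  rintro h
  cases h with
  | left _ _ _ h => cases h
  | right _ _ _ h => cases h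

/-- Contracting the leftmost thin leaf turns it into a cherry one level higher; any other
contraction leaves the leftmost end alone. The parameter `k` is thus an invariant that survives
removing thin leaves in an uncontrolled order. -/
theorem LeftEnd.contract {k : ℕ} {T T' : OTree} (h : LeftEnd k T) (hc : Contract T T') :
    LeftEnd k T' := by
  induction h generalizing T' with
  | cherry R =>
    cases hc with
    | left _ _ _ h => cases h
    | right _ _ _ h =>
      cases h with
      | left _ _ _ h => cases h
      | right _ _ _ h => exact .cherry _
  | thin R =>
    cases hc with
    | here => exact .cherry R
    | left _ _ _ h => exact absurd h not_contract_edge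
    | right _ _ _ h => exact .thin _
  | step k L R h ih =>
    cases hc with
    | here =>
      cases h with
      | step _ _ _ h => cases h
    | left _ _ _ hc => exact .step _ _ _ (ih hc)
    | right _ _ _ _ => exact .step _ _ _ h

theorem exists_rot_iterate_graft_glue {A B X : OTree} {j : ℕ} (hj : j < 2 * (graft A B).edges) :
    j = 0 ∨
    (∃ i < 2 * A.edges,
      rot^[j] ((graft A B).glue X) = rot^[i] (A.glue (graft (B.glue X) vertex))) ∨
    rot^[j] ((graft A B).glue X) = graft (B.glue X) A ∨
    ∃ i < 2 * B.edges,
      rot^[j] ((graft A B).glue X) = rot^[i] (B.glue (X.glue (graft A vertex))) := by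
  have he : (graft A B).edges = A.edges + B.edges + 1 := rfl
  rcases Nat.eq_zero_or_pos j with h0 | h0
  · exact .inl h0
  rcases Nat.lt_or_ge j (2 * A.edges + 1) with h1 | h1
  · refine .inr (.inl ⟨j - 1, by omega, ?_⟩)
    conv_lhs => rw [show j = (j - 1) + 1 by omega, Function.iterate_succ_apply]
    rfl
  rcases Nat.eq_or_lt_of_le h1 with h2 | h2
  · refine .inr (.inr (.inl ?_))
    rw [← h2, rot_iterate_graft_glue]
  · refine .inr (.inr (.inr ⟨j - (1 + 2 * A.edges + 1), by omega, ?_⟩))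
    conv_lhs => rw [show j = j - (1 + 2 * A.edges + 1) + (1 + 2 * A.edges + 1) by omega,
      Function.iterate_add_apply, rot_iterate_graft_glue']

theorem rotEq_left_glue (A B X : OTree) :
    RotEq ((graft A B).glue X) (A.glue (graft (B.glue X) vertex)) := rotEq_rot _

theorem rotEq_right_glue (A B X : OTree) :
    RotEq ((graft A B).glue X) (B.glue (X.glue (graft A vertex))) :=
  ⟨_, rot_iterate_graft_glue' A B X⟩

/-- The size of `X` excludes thin leaves seen on the way up, so the thin leaf and both edges of its
contraction lie inside `L`. -/
theorem exists_contract_glue {L X R : OTree} {j : ℕ} (hj : j < 2 * L.edges) (hX : 2 ≤ X.edges)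
    (h : rot^[j] (L.glue X) = graft edge R) :
    ∃ L', Contract L L' ∧ RotEq (L'.glue X) (graft vertex (graft vertex R)) := by
  induction L generalizing X j with
  | vertex => simp [edges] at hj
  | graft A B ihA ihB =>
    rcases exists_rot_iterate_graft_glue (X := X) hj with rfl | ⟨i, hi, e⟩ | e | ⟨i, hi, e⟩
    · simp only [Function.iterate_zero, id, glue, graft.injEq] at h
      obtain ⟨rfl, rfl⟩ := h
      exact ⟨_, .here B, .refl _⟩
    · obtain ⟨A', hA, hr⟩ := ihA hi (by simp only [edges, edges_glue]; omega) (e.symm.trans h)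
      exact ⟨_, .left _ _ B hA, (rotEq_left_glue _ _ _).trans hr⟩
    · rw [e, graft.injEq] at h
      have := congrArg edges h.1
      rw [edges_glue, edges_edge] at this
      omega
    · obtain ⟨B', hB, hr⟩ := ihB hi (by simp only [edges, edges_glue]; omega) (e.symm.trans h)
      exact ⟨_, .right A _ _ hB, (rotEq_right_glue _ _ _).trans hr⟩

/-- As `B` is nonempty, the root is not thin. So whichever thin leaf is lifted, the change happens
below the edge at the root, and the root stays a leaf. -/
theorem exists_contract {A B R : OTree} (hB : B ≠ vertex)
    (h : RotEq (graft (graft A B) vertex) (graft edge R)) :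
    ∃ L, Contract (graft A B) L ∧
      RotEq (graft L vertex) (graft vertex (graft vertex R)) := by
  have e0 : ∀ L, RotEq (graft L vertex) (L.glue edge) := fun L => rotEq_rot _
  have hB' := edges_pos.2 hB
  obtain ⟨j, hj, h⟩ := ((e0 _).symm.trans h).exists_lt (by simp [glue])
  have hj : j < 2 * (graft (graft A B) vertex).edges := by
    simpa only [edges_glue, edges_edge, edges] using hj
  rcases Nat.lt_or_ge j (2 * (graft A B).edges) with h1 | h1
  · rcases exists_rot_iterate_graft_glue (X := edge) h1 with rfl | ⟨i, hi, e⟩ | e | ⟨i, hi, e⟩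
    · simp only [Function.iterate_zero, id, glue, graft.injEq] at h
      obtain ⟨rfl, rfl⟩ := h
      exact ⟨_, .here B, e0 _⟩
    · obtain ⟨A', hA, hr⟩ := exists_contract_glue hi
        (by simp only [edges, edges_glue, edges_edge]; omega) (e.symm.trans h)
      exact ⟨_, .left _ _ B hA, (e0 _).trans ((rotEq_left_glue _ _ _).trans hr)⟩
    · rw [e, graft.injEq] at h
      have := congrArg edges h.1
      rw [edges_glue, edges_edge] at this
      omega
    · obtain ⟨B', hB, hr⟩ := exists_contract_glue hi
        (by simp only [edges, edges_glue, edges_edge]; omega) (e.symm.trans h)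
      exact ⟨_, .right A _ _ hB, (e0 _).trans ((rotEq_right_glue _ _ _).trans hr)⟩
  -- The two positions left belong to the edge at the root leaf; the second would make that leaf
  -- thin, against `hB`.
  · exfalso
    obtain ⟨i, rfl⟩ := Nat.exists_eq_add_of_le' h1
    have hi : i < 2 := by simp only [edges] at hj h1 ⊢; omega
    rw [Function.iterate_add_apply, rot_iterate_glue] at h
    interval_cases i
    · simp [edge, glue] at h
    · simp only [edge, glue, rot, Function.iterate_one, graft.injEq] at h
      exact hB h.1.2

/-! ### Rooting at a leaf before a cherry -/

/-- Descend into a nontrivial branch among the first two: it is not a single edge, since that would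
be a thin leaf, so it again has two edges. If the first two branches are trivial, they form the
cherry. -/
theorem exists_cherry {L : OTree} (hL : 2 ≤ L.edges) (ht : innerThin L = 0) (X : OTree) :
    ∃ R, RotEq (L.glue X) (graft vertex (graft vertex R)) := by
  induction hn : L.edges using Nat.strong_induction_on generalizing L X with
  | _ n ih =>
    subst hn
    have key : ∀ A B X, A ≠ vertex → (graft A B).edges ≤ L.edges → innerThin (graft A B) = 0 →
        ∃ R, RotEq ((graft A B).glue X) (graft vertex (graft vertex R)) := by
      intro A B X hA he h
      simp only [innerThin] at h
      have hA1 : A.edges ≠ 1 := by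
        rw [Ne, edges_eq_one]
        rintro rfl
        simp at h
      have hA0 := edges_pos.2 hA
      obtain ⟨R, hR⟩ := ih A.edges (by simp only [edges] at he; omega) (by omega) (by omega)
        (graft (B.glue X) vertex) rfl
      exact ⟨R, (rotEq_rot _).trans hR⟩
    cases L with
    | vertex => simp [edges] at hL
    | graft A B =>
      by_cases hA : A = vertex
      · subst hA
        cases B with
        | vertex => simp [edges] at hL
        | graft A B =>
          by_cases hA : A = vertex
          · subst hA
            exact ⟨_, .refl _⟩
          · simp only [innerThin] at ht
            obtain ⟨R, hR⟩ := key A B (X.glue (graft vertex vertex)) hA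
              (by simp only [edges]; omega) (by simp only [innerThin]; omega)
            exact ⟨R, (rotEq_right_glue _ _ _).trans hR⟩
      · exact key A B X hA le_rfl ht

theorem leftSpine_append_cherry (Rs : List OTree) (R : OTree) :
    LeftCherry (leftSpine (Rs ++ [graft vertex R])) := by
  induction Rs with
  | nil => exact .here R
  | cons S Ss ih => exact .step _ _ ih

/-- The new root is the leaf just before the cherry in the walk: the rightmost leaf of the last
branch of `R`. Its leftmost path leads to the cherry. -/
theorem exists_rootLeaf_leftCherry {R : OTree} (hR : R ≠ vertex) :
    ∃ Q, RotEq (graft vertex (graft vertex R)) Q ∧ RootLeaf Q ∧ LeftCherry Q := by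
  obtain ⟨A, B, rfl⟩ := exists_glue_last hR
  obtain ⟨Rs, hRs⟩ := exists_rightSpine B
  refine ⟨leftSpine (vertex :: (Rs.reverse ++ [graft vertex A])), ?_, ⟨_, rfl⟩,
    .step _ _ (leftSpine_append_cherry _ _)⟩
  have h : rightSpine (vertex :: (Rs.reverse ++ [graft vertex A])).reverse =
      rot (graft vertex (graft vertex (A.glue (graft B vertex)))) := by
    simp [rot, rightSpine, glue, hRs]
  exact (rotEq_rot _).trans (RotEq.symm ⟨_, (rot_iterate_leftSpine _).trans h⟩)

theorem exists_rotEq_rootLeaf {T : OTree} (hT : T ≠ vertex) : ∃ L, RotEq T (graft L vertex) := by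
  induction hd : T.leftDepth generalizing T with
  | zero => cases T <;> simp [leftDepth] at hd hT
  | succ d ih =>
    cases T with
    | vertex => exact absurd rfl hT
    | graft L R =>
      by_cases hL : L = vertex
      · subst hL
        exact ⟨R, rotEq_rot _⟩
      · obtain ⟨L', h⟩ := ih (T := rot (graft L R))
          (RotEq.ne_vertex (rotEq_rot _) hT)
          (by rw [rot, leftDepth_glue hL]; simpa [leftDepth] using hd)
        exact ⟨L', (rotEq_rot _).trans h⟩

theorem exists_leftCherry_of_thinLeaves_eq_zero {T : OTree} (hT : 3 ≤ T.edges)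
    (h : thinLeaves T = 0) : ∃ Q, RotEq T Q ∧ RootLeaf Q ∧ LeftCherry Q := by
  obtain ⟨L, hL⟩ := exists_rotEq_rootLeaf (edges_pos.1 (by omega : 0 < T.edges))
  rw [← hL.edges_eq] at hT
  rw [← hL.thinLeaves_eq] at h
  cases L with
  | vertex => simp [edges] at hT
  | graft A B =>
    obtain ⟨R, hR⟩ := exists_cherry (L := graft A B) (by simp only [edges] at hT ⊢; omega)
      (thinLeaves_eq_zero_rootLeaf h).2 edge
    have hR := hL.trans ((rotEq_rot (graft (graft A B) vertex)).trans hR)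
    have hR0 : R ≠ vertex := by
      rintro rfl
      have := hR.edges_eq
      rw [hL.edges_eq.symm] at this
      simp only [edges] at this hT
      omega
    obtain ⟨Q, h1, h2⟩ := exists_rootLeaf_leftCherry hR0
    exact ⟨Q, hR.trans h1, h2⟩


/-! ### The excluded tree and canonical representatives -/

theorem thinLeaves_graft_edge_eq {R : OTree} (hR : 2 ≤ R.edges) :
    thinLeaves (graft edge R) = 1 + innerThin R := by
  have hR1 : R ≠ edge := ne_of_edges_ne (by rw [edges_edge]; omega)
  rw [thinLeaves_graft, if_pos rfl, if_neg hR1, thinCount_glue R _ (by simp [edges]),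
    thinCount_glue edge _ (by simp only [edges]; omega), innerThin_edge, add_zero, add_zero]

/-- Three edges do not suffice: the path has two thin leaves, but its lift, the star, has none. -/
theorem LiftLeft.thinLeaves_eq {S T : OTree} (h : LiftLeft S T) (hS : 4 ≤ S.edges) :
    thinLeaves S = thinLeaves T + 1 := by
  obtain ⟨R, h1, h2⟩ := h.exists_rotEq
  have he := h1.edges_eq
  simp only [edges, edges_edge] at he
  rw [← h1.thinLeaves_eq, ← h2.thinLeaves_eq, thinLeaves_graft_edge_eq (by omega),
    thinLeaves_graft_vertex_vertex (edges_pos.1 (by omega)), add_comm]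

theorem bits_glue (S T : OTree) : (S.glue T).bits = S.bits ++ T.bits := by
  induction S with
  | vertex => rfl
  | graft L R _ ih => simp [glue, bits, ih]

theorem bits_path (k : ℕ) :
    (path k).bits = List.replicate k true ++ List.replicate k false := by
  induction k with
  | zero => rfl
  | succ k ih =>
    rw [path, bits, ih, bits, List.replicate_succ, List.replicate_succ']
    simp

/-- The tree `(1)^{m+2} ∘ (0)^{m+1} ∘ (1,0,0)`. -/
def exceptional (m : ℕ) : OTree := graft (graft (path m) edge) vertex

theorem edges_exceptional (m : ℕ) : (exceptional m).edges = m + 3 := by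
  simp [exceptional, edges, edges_path]

theorem bits_exceptional (m : ℕ) : (exceptional m).bits =
    List.replicate (m + 2) true ++ List.replicate (m + 1) false ++ [true, false, false] := by
  have : exceptional m = graft ((path (m + 1)).glue edge) vertex := rfl
  rw [this, bits, bits_glue, bits_path, List.replicate_succ (n := m + 1)]
  simp [bits, edge]

theorem bits_eq_excluded {T : OTree} {m : ℕ} (hT : T.edges = m + 3) :
    T.bits = List.replicate (T.edges - 1) true ++ List.replicate (T.edges - 2) false
      ++ [true, false, false] ↔ T = exceptional m := by
  rw [hT, show m + 3 - 1 = m + 2 from rfl, show m + 3 - 2 = m + 1 from rfl, ← bits_exceptional]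
  exact bits_injective.eq_iff

theorem exists_tau2_exceptional (m : ℕ) : ∃ T, Tau2 (exceptional (m + 1)) T := by
  obtain ⟨Ts, h⟩ := path_eq_spine m
  refine ⟨_, vertex, vertex, Ts, ?_, rfl⟩
  rw [← h]
  rfl

theorem exists_liftLeft_path (k : ℕ) : ∃ D, LiftLeft (path (k + 2)) D := by
  induction k with
  | zero => exact ⟨_, .here vertex⟩
  | succ k ih =>
    obtain ⟨D, h⟩ := ih
    exact ⟨_, .step _ _ vertex h⟩

theorem exists_liftLeft_exceptional (m : ℕ) : ∃ D, LiftLeft (exceptional (m + 1)) D := by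
  cases m with
  | zero => exact ⟨_, .step _ _ _ (.here edge)⟩
  | succ k =>
    obtain ⟨D, h⟩ := exists_liftLeft_path k
    exact ⟨_, .step _ _ _ (.step _ _ _ h)⟩

theorem LiftLeft.rootLeaf {S T : OTree} (h : LiftLeft S T) (hS : RootLeaf S) (he : 3 ≤ S.edges) :
    RootLeaf T := by
  obtain ⟨L, rfl⟩ := hS
  cases h with
  | here => simp [edges] at he
  | step L L' R h => exact ⟨_, rfl⟩

theorem LiftLeft.rootLeaf_left {S T : OTree} (h : LiftLeft S T) (hT : RootLeaf T) :
    RootLeaf S := by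
  obtain ⟨L, rfl⟩ := hT
  cases h with
  | step L L' R h => exact ⟨_, rfl⟩

/-- Among the rotated versions of `T` whose root is a leaf and whose leftmost leaf has a leaf as
its right neighbour, `T` has the deepest leftmost leaf and is lexicographically smallest. -/
def IsCanonical (T : OTree) : Prop :=
  ∀ Q : OTree, RotEq T Q → RootLeaf Q → LeftCherry Q →
    Q.leftDepth ≤ T.leftDepth ∧ (Q.leftDepth = T.leftDepth → T.bits ≤ Q.bits)

theorem IsCanonical.unique {T S : OTree} (hT : IsCanonical T) (hS : IsCanonical S)
    (h : RotEq T S) (rT : RootLeaf T) (rS : RootLeaf S) (cT : LeftCherry T) (cS : LeftCherry S) :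
    T = S := by
  obtain ⟨h1, h2⟩ := hT S h rS cS
  obtain ⟨h3, h4⟩ := hS T h.symm rT cT
  have e := le_antisymm h1 h3
  exact bits_injective (le_antisymm (h2 e) (h4 e.symm))

theorem exists_isCanonical {T : OTree} (rT : RootLeaf T) (cT : LeftCherry T) :
    ∃ Q, RotEq T Q ∧ RootLeaf Q ∧ LeftCherry Q ∧ T.leftDepth ≤ Q.leftDepth ∧ IsCanonical Q := by
  have hfin : {Q | RotEq T Q ∧ RootLeaf Q ∧ LeftCherry Q}.Finite :=
    (finite_rotEq T).subset fun Q h => h.1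
  obtain ⟨M, hM, hmax⟩ := Set.exists_max_image _ leftDepth hfin ⟨T, .refl T, rT, cT⟩
  obtain ⟨Q, ⟨⟨hQ, rQ, cQ⟩, hd⟩, hmin⟩ := Set.exists_min_image
    ({Q | RotEq T Q ∧ RootLeaf Q ∧ LeftCherry Q} ∩ {Q | Q.leftDepth = M.leftDepth}) bits
    (hfin.subset Set.inter_subset_left) ⟨M, hM, rfl⟩
  refine ⟨Q, hQ, rQ, cQ, ?_, ?_⟩
  · rw [show Q.leftDepth = M.leftDepth from hd]
    exact hmax T ⟨.refl T, rT, cT⟩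
  · intro S hS rS cS
    rw [show Q.leftDepth = M.leftDepth from hd]
    exact ⟨hmax S ⟨hQ.trans hS, rS, cS⟩, fun e => hmin S ⟨⟨hQ.trans hS, rS, cS⟩, e⟩⟩

/-- Unless `S` is a path, there is a next leaf to hang onto `v`. The new leaf is thin and two levels
deeper than the leftmost leaf of `T`, whence the index `T.leftDepth + 1`. -/
theorem LiftLeft.exists_moveNext {S T : OTree} (h : LiftLeft S T) :
    (∃ k, S = path (k + 2)) ∨ ∃ Q, MoveNext S Q ∧ LeftEnd (T.leftDepth + 1) Q := by
  induction h with
  | here R =>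
    by_cases hR : R = vertex
    · exact .inl ⟨0, by rw [hR]; rfl⟩
    · obtain ⟨R', h⟩ := DropLeft.exists hR
      exact .inr ⟨_, .branch 0 R R' h, .step _ _ _ (.thin vertex)⟩
  | step L L' R h ih =>
    rcases ih with ⟨k, rfl⟩ | ⟨Q, h1, h2⟩
    · by_cases hR : R = vertex
      · exact .inl ⟨k + 1, by rw [hR]; rfl⟩
      · obtain ⟨R', hR⟩ := DropLeft.exists hR
        refine .inr ⟨_, .branch (k + 1) R R' hR, ?_⟩
        have := h.leftDepth_eq
        rw [leftDepth_path] at this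
        rw [leftDepth, ← this]
        exact .step _ _ _ (leftEnd_path (k + 1))
    · exact .inr ⟨_, .step _ _ R h1, .step _ _ _ h2⟩

theorem MoveNext.three_le {S Q : OTree} (h : MoveNext S Q) : 3 ≤ S.edges := by
  induction h with
  | branch k R R' h =>
    have := h.edges_eq
    simp only [edges, edges_path]
    omega
  | step L L' R _ ih => simp only [edges]; omega

/-- The condition on `B'` keeps the root from becoming a thin leaf. It fails only if the moved leaf
was the whole side branch at the neighbour of the root and the rest is a path, which is the
exceptional tree. -/
theorem LiftLeft.exists_moveNext_rootLeaf {S A B : OTree}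
    (h : LiftLeft S (graft (graft A B) vertex)) (hB : B ≠ vertex) (hS : 4 ≤ S.edges) :
    (∃ k, S = exceptional k) ∨ ∃ A' B', B' ≠ vertex ∧
      MoveNext S (graft (graft A' B') vertex) ∧
      LeftEnd ((graft A B).leftDepth + 1) (graft A' B') := by
  cases h with
  | step L _ _ h =>
    rcases h.exists_moveNext with ⟨k, rfl⟩ | ⟨Q, h1, h2⟩
    · exfalso
      simp only [edges, edges_path] at hS
      rw [path] at h
      generalize hp : path (k + 1) = P at h
      cases h with
      | here =>
        have := edges_path (k + 1)
        rw [hp, edges_edge] at this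
        omega
      | step => exact hB rfl
    · cases h1 with
      | branch k R R' hR =>
        by_cases hR' : R' = vertex
        · left
          have := hR.edges_eq
          rw [hR', edges, zero_add, edges_eq_one] at this
          exact ⟨k + 1, by rw [this]; rfl⟩
        · exact .inr ⟨_, _, hR', .step _ _ _ (.branch k R R' hR), h2⟩
      | step L L' R h1 =>
        refine .inr ⟨_, _, ?_, .step _ _ _ (.step _ _ R h1), h2⟩
        cases h with
        | here => exact absurd h1.three_le (by simp)
        | step => exact hB

theorem Tau2.four_le {T T' : OTree} (h : Tau2 T T') : 4 ≤ T.edges := by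
  obtain ⟨T₀, T₁, Ts, rfl, -⟩ := h
  have := edges_spine T₁ Ts path2 vertex
  simp only [edges, edges_glue, edges_edge, path2] at this ⊢
  omega

theorem dom1_iff {T : OTree} : Dom1 T ↔ 3 ≤ T.edges ∧ ∃ R, T = graft edge R := Iff.rfl

theorem length_bits (T : OTree) : T.bits.length = 2 * T.edges := by
  induction T with
  | vertex => rfl
  | graft L R ihL ihR => simp [bits, edges, ihL, ihR]; omega

instance finite_edges_eq (n : ℕ) : Finite {T : OTree // T.edges = n} := by
  have := (List.finite_length_eq Bool (2 * n)).to_subtype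
  refine Finite.of_injective
    (fun T => (⟨T.1.bits, by simp [length_bits, T.2]⟩ :
      {l : List Bool | l.length = 2 * n})) ?_
  intro S T h
  exact Subtype.ext (bits_injective (congrArg Subtype.val h))

end OTree

/-! ### Plane trees as nodes, and the edge-counting criterion for trees -/

instance PlaneTree.finite (n : ℕ) : Finite (PlaneTree n) := Quotient.finite _

theorem PlaneTree.mk_eq_mk {n : ℕ} {S T : OTree} {hS : S.edges = n} {hT : T.edges = n} :
    PlaneTree.mk S hS = PlaneTree.mk T hT ↔ OTree.RotEq S T :=
  Quotient.eq (r := OTree.rotSetoid n)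

theorem PlaneTree.exists_mk {n : ℕ} (P : PlaneTree n) : ∃ T h, P = PlaneTree.mk T h := by
  obtain ⟨⟨T, h⟩, rfl⟩ := Quotient.exists_rep P
  exact ⟨T, h, rfl⟩

namespace DiMultigraph

variable {V E : Type*}

/-- A connected multigraph with fewer edges than nodes is a tree. -/
theorem isTree_of_injective [Finite V] (G : DiMultigraph V E)
    (hG : (SimpleGraph.fromEdgeSet (Set.range G.ends)).Connected) (f : E → V)
    (hf : Function.Injective f) (v : V) (hv : v ∉ Set.range f) : G.IsTree := by
  have : Finite E := Finite.of_injective f hf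
  have hcard : Nat.card E + 1 ≤ Nat.card V := by
    have h1 : (Set.range f).ncard = Nat.card E := by
      rw [← Nat.card_coe_set_eq]
      exact Nat.card_range_of_injective hf
    have h2 := Set.ncard_lt_card (s := Set.range f) fun h => hv (h ▸ Set.mem_univ v)
    omega
  -- Node count ≤ non-loop end pairs + 1 ≤ end pairs + 1 ≤ edges + 1 ≤ node count. Equality
  -- throughout excludes loops and multiple edges and gives the tree count.
  have hconn := hG.card_vert_le_card_edgeSet_add_one
  rw [SimpleGraph.edgeSet_fromEdgeSet, Nat.card_coe_set_eq] at hconn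
  have hsub : Set.range G.ends \ Sym2.diagSet ⊆ Set.range G.ends := Set.sdiff_subset
  have hle := Set.ncard_le_ncard hsub (Set.finite_range _)
  have hrange := Finite.card_range_le G.ends
  rw [Nat.card_coe_set_eq] at hrange
  have heq := Set.eq_of_subset_of_ncard_le hsub (by omega) (Set.finite_range _)
  refine ⟨?_, ?_, ?_⟩
  · intro e he
    exact (heq.ge (Set.mem_range_self e)).2 he
  · have h := Set.rangeFactorization_surjective (f := G.ends) |>.bijective_of_nat_card_le
      (by rw [Nat.card_coe_set_eq]; omega)
    intro a b hab
    exact h.1 (Subtype.ext hab)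
  · rw [SimpleGraph.isTree_iff_connected_and_card]
    refine ⟨hG, ?_⟩
    rw [SimpleGraph.edgeSet_fromEdgeSet, Nat.card_coe_set_eq]
    omega

theorem reachable_ends (G : DiMultigraph V E) (e : E) :
    (SimpleGraph.fromEdgeSet (Set.range G.ends)).Reachable (G.src e) (G.tgt e) := by
  by_cases h : G.src e = G.tgt e
  · rw [h]
  · exact SimpleGraph.Adj.reachable ((SimpleGraph.fromEdgeSet_adj _).2 ⟨⟨e, rfl⟩, h⟩)

end DiMultigraph

namespace OTree

/-! ### Connectedness -/

/-- The rotation classes of `T` and `S` are connected by selected edges. -/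
def Linked (n : ℕ) (T S : OTree) : Prop :=
  ∃ hT hS, (SimpleGraph.fromEdgeSet
    (Set.range ((flipGraph n).restrict (selectedEdges n)).ends)).Reachable
      (PlaneTree.mk T hT) (PlaneTree.mk S hS)

variable {n : ℕ} {T S U : OTree}

theorem Linked.trans (h : Linked n T S) (h' : Linked n S U) : Linked n T U := by
  obtain ⟨hT, _, h⟩ := h
  obtain ⟨_, hU, h'⟩ := h'
  exact ⟨hT, hU, h.trans h'⟩

theorem Linked.symm (h : Linked n T S) : Linked n S T := by
  obtain ⟨hT, hS, h⟩ := h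
  exact ⟨hS, hT, h.symm⟩

theorem Linked.of_rotEq (hT : T.edges = n) (h : RotEq T S) : Linked n T S := by
  refine ⟨hT, h.edges_eq.trans hT, ?_⟩
  rw [PlaneTree.mk_eq_mk (hT := h.edges_eq.trans hT) |>.2 h]

theorem Linked.of_tau1 (hT : T.edges = n) (h : Tau1 T S) (hf : IsFlipTree1 T) : Linked n T S :=
  ⟨hT, h.edges_eq.trans hT, DiMultigraph.reachable_ends
    ((flipGraph n).restrict (selectedEdges n)) ⟨Sum.inl ⟨(T, S), hT, h⟩, hf⟩⟩

theorem Linked.of_tau2 (hT : T.edges = n) (h : Tau2 T S) (hf : IsFlipTree2 T) : Linked n T S :=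
  ⟨hT, h.edges_eq.trans hT, DiMultigraph.reachable_ends
    ((flipGraph n).restrict (selectedEdges n)) ⟨Sum.inr ⟨(T, S), hT, h⟩, hf⟩⟩

/-- The selected `τ₁`-edge belongs to the lexicographically smallest version, so the thin leaf to be
lifted cannot be prescribed; hence the new `R'`. -/
theorem exists_linked_contract (hn : 3 ≤ n) (hT : T.edges = n) {R : OTree}
    (h : RotEq T (graft edge R)) :
    ∃ R', RotEq T (graft edge R') ∧ Linked n T (graft vertex (graft vertex R')) := by
  obtain ⟨M, ⟨hM, dM⟩, hmin⟩ := Set.exists_min_image {S | RotEq T S ∧ Dom1 S} bits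
    ((finite_rotEq T).subset fun S h => h.1)
    ⟨_, h, dom1_iff.2 ⟨by rw [h.edges_eq]; omega, R, rfl⟩⟩
  have heM : M.edges = n := hM.edges_eq.trans hT
  obtain ⟨R', rfl⟩ := (dom1_iff.1 dM).2
  exact ⟨R', hM, (Linked.of_rotEq hT hM).trans (Linked.of_tau1 heM ⟨by omega, R', rfl, rfl⟩
    fun S hS dS => hmin S ⟨hM.trans hS, dS⟩)⟩

theorem linked_contract (hn : 3 ≤ n) (hT : T.edges = n) (h1 : thinLeaves T ≤ 1) {R : OTree}
    (h : RotEq T (graft edge R)) : Linked n T (graft vertex (graft vertex R)) := by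
  obtain ⟨R', h', hl⟩ := exists_linked_contract hn hT h
  rwa [graft_edge_unique h1 h h']

theorem RotEq.contract_lt {R : OTree} (hT : 3 ≤ T.edges) (h : RotEq T (graft edge R)) :
    thinLeaves (graft vertex (graft vertex R)) < thinLeaves T := by
  have he := h.edges_eq
  simp only [edges, edges_edge] at he
  rw [← h.thinLeaves_eq]
  exact thinLeaves_contract_lt (edges_pos.1 (by omega))

theorem Linked.edges_right (h : Linked n T S) : S.edges = n := h.2.1

theorem exists_linked_thinLeaves_eq_zero (hn : 3 ≤ n) (hT : T.edges = n) :
    ∃ S, Linked n T S ∧ thinLeaves S = 0 := by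
  induction hN : thinLeaves T using Nat.strong_induction_on generalizing T with
  | _ N ih =>
    subst hN
    rcases Nat.eq_zero_or_pos (thinLeaves T) with h0 | h0
    · exact ⟨T, .of_rotEq hT (.refl T), h0⟩
    · obtain ⟨R₀, hR₀⟩ := thinLeaves_pos h0
      obtain ⟨R, hR, hl⟩ := exists_linked_contract hn hT hR₀
      obtain ⟨S, h1, h2⟩ := ih _ (hR.contract_lt (by omega)) hl.edges_right rfl
      exact ⟨S, hl.trans h1, h2⟩

/-- Contract thin leaves until none is left. The leaf root, the nonempty `B` and the index `k`
survive each contraction, and at the end the leftmost path must stop at a cherry. -/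
theorem exists_linked_leftCherry (hn : 3 ≤ n) {A B : OTree} {k : ℕ}
    (hT : (graft (graft A B) vertex).edges = n) (hB : B ≠ vertex) (hk : LeftEnd k (graft A B)) :
    ∃ S, Linked n (graft (graft A B) vertex) S ∧ thinLeaves S = 0 ∧ RootLeaf S ∧ LeftCherry S ∧
      S.leftDepth = k + 1 := by
  induction hN : thinLeaves (graft (graft A B) vertex) using Nat.strong_induction_on
    generalizing A B with
  | _ N ih =>
    subst hN
    rcases Nat.eq_zero_or_pos (thinLeaves (graft (graft A B) vertex)) with h0 | h0
    · obtain ⟨h1, h2⟩ := hk.leftCherry (thinLeaves_eq_zero_rootLeaf h0).2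
      exact ⟨_, .of_rotEq hT (.refl _), h0, ⟨_, rfl⟩, .step _ _ h1, by rw [leftDepth, h2]⟩
    · obtain ⟨R₀, hR₀⟩ := thinLeaves_pos h0
      obtain ⟨R, hR, hl⟩ := exists_linked_contract hn hT hR₀
      obtain ⟨L, hL, hLR⟩ := exists_contract hB hR
      have hlt := hR.contract_lt (by omega)
      rw [hLR.thinLeaves_eq] at hlt
      have he : (graft L vertex).edges = n := by rw [← hLR.edges_eq, hl.edges_right]
      obtain ⟨A', B', rfl, hB'⟩ : ∃ A' B', L = graft A' B' ∧ B' ≠ vertex := by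
        cases hL with
        | here => exact ⟨_, _, rfl, by simp⟩
        | left _ _ _ _ => exact ⟨_, _, rfl, hB⟩
        | right _ _ _ h => exact ⟨_, _, rfl, by rintro rfl; cases h⟩
      obtain ⟨S, h1, h2⟩ := ih _ hlt he hB' (hk.contract hL) rfl
      exact ⟨S, (hl.trans (Linked.of_rotEq he hLR).symm).trans h1, h2⟩

/-- The route is `T`, its canonical version `Q`, back along `τ₁` to the unlifted `S`, along `τ₂` to
a tree with a longer leftmost path, and along `τ₁` to a class without thin leaves. -/
theorem exists_linked_deeper {D : OTree} (hn : 4 ≤ n)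
    (hD : LiftLeft (exceptional (n - 3)) D) (hT : T.edges = n) (h0 : thinLeaves T = 0)
    (rT : RootLeaf T) (cT : LeftCherry T) :
    RotEq T D ∨ ∃ S, Linked n T S ∧ thinLeaves S = 0 ∧ RootLeaf S ∧ LeftCherry S ∧
      T.leftDepth < S.leftDepth := by
  obtain ⟨Q, hQ, rQ, cQ, hdepth, canQ⟩ := exists_isCanonical rT cT
  have heQ : Q.edges = n := hQ.edges_eq.trans hT
  have hQ0 : thinLeaves Q = 0 := by rw [hQ.thinLeaves_eq, h0]
  obtain ⟨S, hSQ⟩ := cQ.exists_liftLeft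
  have heS : S.edges = n := by rw [← hSQ.edges_eq, heQ]
  have hS1 : thinLeaves S ≤ 1 := by rw [hSQ.thinLeaves_eq (by omega)]; omega
  -- With one thin leaf, all lifts of rotated versions of `S` lie in one class.
  have uniq : ∀ {S' Q'}, RotEq S S' → LiftLeft S' Q' → RotEq Q Q' := by
    intro S' Q' h h'
    obtain ⟨R, h1, h2⟩ := hSQ.exists_rotEq
    obtain ⟨R', h3, h4⟩ := h'.exists_rotEq
    rw [graft_edge_unique hS1 h1 (h.trans h3)] at h2
    exact h2.trans h4.symm
  have main : ∀ {X}, RotEq S X → X = exceptional (n - 3) → RotEq T D := by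
    rintro X h rfl
    exact hQ.trans (uniq h hD)
  have rS := hSQ.rootLeaf_left rQ
  obtain ⟨L, rfl⟩ := rQ
  cases L with
  | vertex => simp [edges] at heQ; omega
  | graft A B =>
    have hB := (thinLeaves_eq_zero_rootLeaf hQ0).1
    rcases hSQ.exists_moveNext_rootLeaf hB (by omega) with ⟨k, hk⟩ | ⟨A', B', hB', hmove, hend⟩
    · left
      refine main (.refl S) (hk.trans ?_)
      rw [hk, edges_exceptional] at heS
      congr
      omega
    · obtain ⟨X, X', hX, hXS, hX'⟩ := hmove.exists_tau2 hS1
      have heX : X.edges = n := by rw [← hXS.edges_eq, heS]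
      -- If the `τ₂`-source is the excluded tree, no selected edge is available, but then `T` is
      -- already in the class of its lift `D`.
      by_cases hexc : X = exceptional (n - 3)
      · exact .inl (main hXS.symm hexc)
      right
      have hflip : IsFlipTree2 X := by
        refine ⟨?_, by rwa [← hXS.thinLeaves_eq], S, _, hXS, rS, hSQ, canQ⟩
        rwa [Ne, bits_eq_excluded (m := n - 3) (by omega)]
      have l1 : Linked n X _ := Linked.of_tau2 heX hX hflip
      have l2 : Linked n X' _ := Linked.of_rotEq l1.edges_right hX'
      obtain ⟨Z, l3, hZ0, rZ, cZ, hZ⟩ := exists_linked_leftCherry (by omega) l2.edges_right hB' hend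
      obtain ⟨R, h1, h2⟩ := hSQ.exists_rotEq
      have l4 := linked_contract (by omega) heS hS1 h1
      refine ⟨Z, ?_, hZ0, rZ, cZ, ?_⟩
      · exact (Linked.of_rotEq hT (hQ.trans h2)).trans (l4.symm.trans
          ((Linked.of_rotEq heS hXS.symm).trans (l1.trans (l2.trans l3))))
      · rw [leftDepth] at hdepth
        omega

theorem linked_sink {D : OTree} (hn : 4 ≤ n) (hD : LiftLeft (exceptional (n - 3)) D)
    (hT : T.edges = n) (h0 : thinLeaves T = 0) (rT : RootLeaf T) (cT : LeftCherry T) :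
    Linked n T D := by
  induction hd : n - T.leftDepth using Nat.strong_induction_on generalizing T with
  | _ d ih =>
    rcases exists_linked_deeper hn hD hT h0 rT cT with h | ⟨S, hS, hS0, rS, cS, hlt⟩
    · exact .of_rotEq hT h
    · have := leftDepth_le_edges S
      have heS := hS.edges_right
      exact hS.trans (ih _ (by omega) heS hS0 rS cS rfl)

/-! ### Counting the selected edges -/

/-- The condition in `IsFlipTree2` on the tree `T'` obtained from `T` by lifting its thin leaf. -/
def Lifts (T T' : OTree) : Prop :=
  ∃ S, RotEq T S ∧ RootLeaf S ∧ LiftLeft S T' ∧ IsCanonical T'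

theorem Lifts.edges_eq (h : Lifts T U) : U.edges = T.edges := by
  obtain ⟨S, h1, _, h2, _⟩ := h
  rw [h2.edges_eq, h1.edges_eq]

theorem Lifts.thinLeaves_eq_zero (h : Lifts T U) (hT : 4 ≤ T.edges) (h1 : thinLeaves T ≤ 1) :
    thinLeaves U = 0 := by
  obtain ⟨S, hS, _, h2, _⟩ := h
  have := h2.thinLeaves_eq (by rw [hS.edges_eq]; exact hT)
  rw [hS.thinLeaves_eq] at this
  omega

/-- Both lifts are canonical in one class, hence equal; lifting is injective, so the unlifted trees
agree, and with them the `τ₂`-sources. -/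
theorem Lifts.unique {T' U' V V' : OTree} (hT : Tau2 T V) (hU : Tau2 U V') (h1 : thinLeaves T ≤ 1)
    (lT : Lifts T T') (lU : Lifts U U') (h : RotEq T' U') : T = U := by
  have eT := hT.four_le
  have eU := hU.four_le
  obtain ⟨S, hS, rS, hl, hc⟩ := lT
  obtain ⟨S', hS', rS', hl', hc'⟩ := lU
  have e := hc.unique hc' h (hl.rootLeaf rS (by rw [hS.edges_eq]; omega))
    (hl'.rootLeaf rS' (by rw [hS'.edges_eq]; omega)) hl.leftCherry hl'.leftCherry
  subst e
  rw [hl.left_unique hl'] at hS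
  exact tau2_source_unique hT hU (hS.trans hS'.symm) h1

/-- At most one edge lies off the leftmost path. If it did not hang at the neighbour of the root,
the root would still be a thin leaf after the lift. -/
theorem eq_exceptional (hn : 4 ≤ n) (hS : S.edges = n) (rS : RootLeaf S)
    (h0 : n ≤ S.leftDepth + 1) (hl : LiftLeft S U) (hU : thinLeaves U = 0) :
    S = exceptional (n - 3) := by
  obtain ⟨L, rfl⟩ := rS
  cases hl with
  | here => simp [edges] at hS; omega
  | step _ L' _ hl =>
    have hB : ∃ A B, L = graft A B ∧ B ≠ vertex := by
      cases hl with
      | here R =>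
        refine ⟨_, _, rfl, edges_pos.1 ?_⟩
        simp only [edges, edges_edge] at hS
        omega
      | step A A' B h => exact ⟨_, _, rfl, (thinLeaves_eq_zero_rootLeaf hU).1⟩
    obtain ⟨A, B, rfl, hB⟩ := hB
    have := edges_pos.2 hB
    have := leftDepth_le_edges A
    simp only [edges, leftDepth] at hS h0
    have hA := eq_path_of_edges_le (T := A) (by omega)
    rw [edges_eq_one.1 (show B.edges = 1 by omega), hA, exceptional,
      show A.leftDepth = n - 3 by omega]

theorem leftDepth_exceptional (m : ℕ) : (exceptional m).leftDepth = m + 2 := by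
  simp [exceptional, leftDepth, leftDepth_path]

/-- A canonical lift is at least as deep as `D`, which forces the unlifted tree to be the
exceptional one. That tree is itself a `τ₂`-source, so it is the only one in its class. -/
theorem Lifts.eq_exceptional {D V : OTree} (hn : 4 ≤ n) (hD : LiftLeft (exceptional (n - 3)) D)
    (hT : T.edges = n) (tT : Tau2 T V) (h1 : thinLeaves T ≤ 1) (lT : Lifts T U) (h : RotEq U D) :
    T = exceptional (n - 3) := by
  have hU := lT.thinLeaves_eq_zero (by omega) h1
  obtain ⟨S, hS, rS, hl, hc⟩ := lT
  have rD : RootLeaf D := hD.rootLeaf ⟨_, rfl⟩ (by rw [edges_exceptional]; omega)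
  have hd := (hc D h rD hD.leftCherry).1
  have e1 := hD.leftDepth_eq
  have e2 := hl.leftDepth_eq
  rw [leftDepth_exceptional] at e1
  have hS' := OTree.eq_exceptional hn (hS.edges_eq.trans hT) rS (by omega) hl hU
  obtain ⟨W, hW⟩ := exists_tau2_exceptional (n - 4)
  rw [show n - 4 + 1 = n - 3 by omega, ← hS'] at hW
  rw [← hS']
  exact tau2_source_unique tT hW hS h1

theorem innerThin_path (k : ℕ) : innerThin (path (k + 2)) = 1 := by
  induction k with
  | zero => simp [path, innerThin, edge]
  | succ k ih => rw [path, innerThin, ih, if_neg (by simp [path, edge])]; rfl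

theorem thinLeaves_exceptional (m : ℕ) : thinLeaves (exceptional (m + 1)) = 1 := by
  have h := innerThin_path m
  rw [path, innerThin, innerThin] at h
  rw [exceptional, thinLeaves_rootLeaf, if_neg (by simp [edge]), if_neg (by simp [edge]),
    innerThin, innerThin_edge]
  omega

/-- A rotation class without thin leaves that all such classes are linked to, and that is not the
lift of the source of a selected `τ₂`-edge. -/
theorem exists_sink (hn : 3 ≤ n) : ∃ D : OTree, D.edges = n ∧ thinLeaves D = 0 ∧
    (∀ T : OTree, T.edges = n → thinLeaves T = 0 → Linked n T D) ∧
    ∀ T V U : OTree, T.edges = n → Tau2 T V → IsFlipTree2 T → Lifts T U → ¬ RotEq U D := by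
  rcases Nat.eq_or_lt_of_le hn with rfl | hn
  -- For `n = 3` the sink is the star, the only class without thin leaves; `τ₂` needs four edges.
  · refine ⟨exceptional 0, rfl, ?_, ?_, ?_⟩
    · rw [exceptional, path, thinLeaves_rootLeaf]
      simp [edge, innerThin]
    · intro T hT h0
      obtain ⟨L, hL⟩ := exists_rotEq_rootLeaf (T := T) (edges_pos.1 (by omega))
      have he := hL.edges_eq
      rw [hT] at he
      cases L with
      | vertex => simp [edges] at he
      | graft A B =>
        have hB := edges_pos.2 (thinLeaves_eq_zero_rootLeaf (hL.thinLeaves_eq.trans h0)).1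
        simp only [edges] at he
        rw [edges_eq_zero.1 (show A.edges = 0 by omega),
          edges_eq_one.1 (show B.edges = 1 by omega)] at hL
        exact Linked.of_rotEq hT hL
    · intro T V U hT tT
      have := tT.four_le
      omega
  · obtain ⟨D, hD⟩ := exists_liftLeft_exceptional (n - 4)
    have hD1 := hD.thinLeaves_eq (by rw [edges_exceptional]; omega)
    rw [thinLeaves_exceptional] at hD1
    rw [show n - 4 + 1 = n - 3 by omega] at hD
    have he : D.edges = n := by rw [hD.edges_eq, edges_exceptional]; omega
    refine ⟨D, he, by omega, ?_, ?_⟩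
    · intro T hT h0
      obtain ⟨Q, hQ, rQ, cQ⟩ := exists_leftCherry_of_thinLeaves_eq_zero (by omega) h0
      exact (Linked.of_rotEq hT hQ).trans (linked_sink (by omega) hD (hQ.edges_eq.trans hT)
        (hQ.thinLeaves_eq.trans h0) rQ cQ)
    · intro T V U hT tT hf lT h
      exact hf.1 ((bits_eq_excluded (m := n - 3) (by omega)).2
        (lT.eq_exceptional (by omega) hD hT tT hf.2.1 h))

theorem Tau1.exists_eq (h : Tau1 T U) : ∃ R, T = graft edge R ∧ R ≠ vertex := by
  obtain ⟨h3, R, rfl, -⟩ := h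
  refine ⟨R, rfl, ?_⟩
  rintro rfl
  simp [edges, path2, glue] at h3

theorem Tau1.thinLeaves_pos (h : Tau1 T U) : 0 < thinLeaves T := by
  obtain ⟨R, rfl, hR⟩ := h.exists_eq
  have := thinLeaves_graft_edge hR
  omega

theorem Tau1.dom1 (h : Tau1 T U) : Dom1 T := by
  obtain ⟨h3, R, rfl, -⟩ := h
  exact ⟨h3, R, rfl⟩

theorem IsFlipTree1.unique {T' U' : OTree} (hT : Tau1 T T') (hU : Tau1 U U')
    (fT : IsFlipTree1 T) (fU : IsFlipTree1 U) (h : RotEq T U) : T = U :=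
  bits_injective (le_antisymm (fT U h hU.dom1) (fU T h.symm hT.dom1))

/-- The tree whose rotation class is matched with a selected edge. -/
def Anchor : FlipEdge n → OTree → Prop
  | Sum.inl p, T => T = p.1.1
  | Sum.inr p, T => Lifts p.1.1 T

theorem exists_anchor (e : selectedEdges n) : ∃ P : {T : OTree // T.edges = n}, Anchor e.1 P.1 := by
  obtain ⟨⟨p, hp⟩ | ⟨p, hp⟩, he⟩ := e
  · exact ⟨⟨p.1, hp.1⟩, rfl⟩
  · obtain ⟨-, -, S, T', h1, h2, h3, h4⟩ : IsFlipTree2 p.1 := he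
    have hl : Lifts p.1 T' := ⟨S, h1, h2, h3, h4⟩
    exact ⟨⟨T', hl.edges_eq.trans hp.1⟩, hl⟩

/-- Edges of different kinds are separated by thin leaves: the anchor of a `τ₁`-edge has one, that
of a selected `τ₂`-edge has none. -/
theorem Anchor.unique {e e' : FlipEdge n} (he : e ∈ selectedEdges n) (he' : e' ∈ selectedEdges n)
    (hT : Anchor e T) (hS : Anchor e' S) (h : RotEq T S) : e = e' := by
  have mixed : ∀ {p q : OTree × OTree}, q.1.edges = n → Tau1 p.1 p.2 → Tau2 q.1 q.2 →
      IsFlipTree2 q.1 → ∀ {U}, Lifts q.1 U → ¬ RotEq U p.1 := by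
    intro p q _ h1 h2 hf U hl h
    have := hl.thinLeaves_eq_zero h2.four_le hf.2.1
    have := h1.thinLeaves_pos
    rw [h.thinLeaves_eq] at this
    omega
  obtain ⟨⟨p, p'⟩, hp⟩ | ⟨⟨p, p'⟩, hp⟩ := e <;> obtain ⟨⟨q, q'⟩, hq⟩ | ⟨⟨q, q'⟩, hq⟩ := e'
  · obtain rfl : T = p := hT
    obtain rfl : S = q := hS
    obtain rfl := IsFlipTree1.unique hp.2 hq.2 he he' h
    obtain rfl : p' = q' := tau1_functional hp.2 hq.2
    rfl
  · obtain rfl : T = p := hT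
    exact absurd h.symm (mixed hq.1 hp.2 hq.2 he' hS)
  · obtain rfl : S = q := hS
    exact absurd h (mixed hp.1 hq.2 hp.2 he hT)
  · have hf : IsFlipTree2 p := he
    obtain rfl : p = q := Lifts.unique hp.2 hq.2 hf.2.1 hT hS h
    obtain rfl : p' = q' := tau2_functional hp.2 hq.2
    rfl

theorem rotEq_of_edges_le_two (hT : T.edges = S.edges) (h2 : T.edges ≤ 2) : RotEq T S := by
  have small : ∀ U : OTree, U.edges ≤ 2 → U = vertex ∨ U = edge ∨ U = path2 ∨ rot path2 = U := by
    intro U hU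
    cases U with
    | vertex => exact .inl rfl
    | graft L R =>
      simp only [edges] at hU
      rcases Nat.eq_zero_or_pos L.edges with hL | hL
      · rcases Nat.eq_zero_or_pos R.edges with hR | hR
        · rw [edges_eq_zero.1 hL, edges_eq_zero.1 hR]
          exact .inr (.inl rfl)
        · rw [edges_eq_zero.1 hL, edges_eq_one.1 (show R.edges = 1 by omega)]
          exact .inr (.inr (.inr rfl))
      · rw [edges_eq_one.1 (show L.edges = 1 by omega),
          edges_eq_zero.1 (show R.edges = 0 by omega)]
        exact .inr (.inr (.inl rfl))
  have hr : RotEq path2 (rot path2) := rotEq_rot _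
  rcases small T h2 with rfl | rfl | rfl | rfl <;>
    rcases small S (hT ▸ h2) with rfl | rfl | rfl | rfl <;>
    first
      | exact .refl _
      | exact hr
      | exact hr.symm
      | simp [edges, edge, path2, rot, glue] at hT

end OTree

/-! ### The spanning tree -/

open OTree

theorem lemma6 (n : ℕ) (hn : 1 ≤ n) :
    (flipGraph n).IsSpanningTree (selectedEdges n) := by
  choose g hg using exists_anchor (n := n)
  have hinj : Function.Injective fun e => PlaneTree.mk (g e).1 (g e).2 := fun e e' h =>
    Subtype.ext (Anchor.unique e.2 e'.2 (hg e) (hg e') (PlaneTree.mk_eq_mk.1 h))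
  suffices h : ∃ D h, (∀ T : OTree, T.edges = n → Linked n T D) ∧
      PlaneTree.mk D h ∉ Set.range fun e => PlaneTree.mk (g e).1 (g e).2 by
    obtain ⟨D, hD, hall, hnot⟩ := h
    refine DiMultigraph.isTree_of_injective _ ?_ _ hinj _ hnot
    rw [SimpleGraph.connected_iff_exists_forall_reachable]
    refine ⟨PlaneTree.mk D hD, fun P => ?_⟩
    obtain ⟨T, hT, rfl⟩ := P.exists_mk
    obtain ⟨_, _, h⟩ := hall T hT
    exact h.symm
  rcases Nat.lt_or_ge 2 n with h3 | h2
  · obtain ⟨D, hD, hD0, hlink, hnot⟩ := exists_sink h3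
    refine ⟨D, hD, fun T hT => ?_, ?_⟩
    · obtain ⟨S, h, hS⟩ := exists_linked_thinLeaves_eq_zero h3 hT
      exact h.trans (hlink S h.edges_right hS)
    · rintro ⟨e, he⟩
      have hr := PlaneTree.mk_eq_mk.1 he
      have ha := hg e
      revert ha hr
      generalize (g e).1 = U
      obtain ⟨⟨p, hp⟩ | ⟨p, hp⟩, hf⟩ := e
      · rintro hr (rfl : U = p.1)
        have := hp.2.thinLeaves_pos
        rw [← hr.thinLeaves_eq] at this
        omega
      · exact fun hr ha => hnot _ _ _ hp.1 hp.2 hf ha hr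
  -- For `n ≤ 2` any representative will do: there is one class, and both `τ₁` and `τ₂` need more
  -- edges.
  · have he : (path n).edges = n := edges_path n
    refine ⟨path n, he, fun T hT => .of_rotEq hT (rotEq_of_edges_le_two (hT.trans he.symm)
      (by omega)), ?_⟩
    rintro ⟨⟨⟨p, hp⟩ | ⟨p, hp⟩, _⟩, _⟩
    · have := hp.2.1
      omega
    · have := hp.2.four_le
      omega
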